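/- Let $m,k\ge 1$ be integers, $n=2m$, $q=2^n$, with $1\le k\le n-1$ and $k\ne m$. Let $d=\gcd(m,k)$ and $d'=\gcd(m+k,2k)$. Let $\mathbb F_q$ be the field with $q$ elements, $\mathbb F_{2^m}$ its subfield of order $2^m$, $\mathrm{Tr}_1^m:\mathbb F_{2^m}\to\mathbb F_2$ and $\mathrm{Tr}_1^n:\mathbb F_q\to\mathbb F_2$ the absolute traces, and $\pi$ a primitive element of $\mathbb F_q$. For $\alpha\in\mathbb F_{2^m}$ and $\beta,\gamma\in\mathbb F_q$ put \[ S(\alpha,\beta,\gamma)=\sum_{x\in\mathbb F_q}(-1)^{\mathrm{Tr}_1^m(\alpha x^{2^m+1})+\mathrm{Tr}_1^n(\beta x^{2^k+1}+\gamma x)},\] \[ c(\alpha,\beta,\gamma)=\Bigl(\mathrm{Tr}_1^m(\alpha\pi^{i(2^m+1)})+\mathrm{Tr}_1^n(\beta\pi^{i(2^k+1)}+\gamma\pi^i)\Bigr)_{i=0}^{q-2}\in\mathbb F_2^{\,q-1}.\] Let $h_1,h_2,h_3$ be the minimal polynomials over $\mathbb F_2$ of $\pi^{-1}$, $\pi^{-(2^k+1)}$,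 $\pi^{-(2^m+1)}$, and let $\mathcal C_2$ be the binary cyclic code of length $q-1$ with parity-check polynomial $h_1h_2h_3$, that is, the set of all words $(c_0,\dots,c_{q-2})$ with $h_1h_2h_3\cdot\sum_i c_iX^i\equiv 0 \pmod{X^{q-1}-1}$. Then $(\alpha,\beta,\gamma)\mapsto c(\alpha,\beta,\gamma)$ is a bijection from $\mathbb F_{2^m}\times\mathbb F_q^2$ onto $\mathcal C_2$. Moreover, the tables below give the value distribution of $S$ and the weight distribution of $\mathcal C_2$ completely. That is, for every triple $(\alpha,\beta,\gamma)$ there is a row containing both the value $S(\alpha,\beta,\gamma)$ and the Hamming weight of $c(\alpha,\beta,\gamma)$; for every row the number of triples $(\alpha,\beta,\gamma)$ for which $S(\alpha,\beta,\gamma)$ is the listed value is the listed multiplicity; every codeword of $\mathcal C_2$ has one of the listed weights; and for every row the number of codewords of $\mathcal C_2$ of the listed weight is the listed multiplicity. (i) If $d'=d$: \[\begin{array}{|c|c|c|}\hline \text{value}&\text{weight}&\text{multiplicity}\\\hline 2^m&2^{n-1}-2^{m-1}&\dfrac{2^{m-1}(2^n-1)(2^{n+2d}-2^{n+d}-2^n+2^{m+2d}-2^{m+d}+2^{2d})}{2^{2d}-1}\\\hline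 -2^m&2^{n-1}+2^{m-1}&\dfrac{2^{m-1}(2^m-1)^2(2^{n+2d}-2^{n+d}-2^n+2^{m+2d}-2^{m+d}+2^{2d})}{2^{2d}-1}\\\hline 2^{m+d}&2^{n-1}-2^{m+d-1}&\dfrac{2^{m-d-1}(2^{m-d}+1)(2^{m+d}-1)(2^n-1)}{2^{2d}-1}\\\hline -2^{m+d}&2^{n-1}+2^{m+d-1}&\dfrac{2^{m-d-1}(2^{m-d}-1)(2^{m+d}-1)(2^n-1)}{2^{2d}-1}\\\hline 0&2^{n-1}&(2^{3m-d}-2^{n-2d}+1)(2^n-1)\\\hline 2^n&0&1\\\hline \end{array}\] (ii) If $d'=2d$: \[\begin{array}{|c|c|c|}\hline \text{value}&\text{weight}&\text{multiplicity}\\\hline 2^m&2^{n-1}-2^{m-1}&\dfrac{2^{m+3d-1}(2^n-1)(2^n-2^{n-2d}-2^{n-3d}+2^m-2^{m-d}+1)}{(2^d+1)(2^{2d}-1)}\\\hline -2^m&2^{n-1}+2^{m-1}&\dfrac{2^{m+3d-1}(2^m-1)^2(2^n-2^{n-2d}-2^{n-3d}+2^m-2^{m-d}+1)}{(2^d+1)(2^{2d}-1)}\\\hline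 2^{m+d}&2^{n-1}-2^{m+d-1}&\dfrac{2^{m-1}(2^{m-d}+1)(2^n-1)(2^m+2^{m-d}+2^{m-2d}+1)}{(2^d+1)^2}\\\hline -2^{m+d}&2^{n-1}+2^{m+d-1}&\dfrac{2^{m-1}(2^{m-d}-1)(2^n-1)(2^m+2^{m-d}+2^{m-2d}+1)}{(2^d+1)^2}\\\hline 2^{m+2d}&2^{n-1}-2^{m+2d-1}&\dfrac{2^{m-2d-1}(2^{m-2d}+1)(2^{m-d}-1)(2^n-1)}{(2^d+1)(2^{2d}-1)}\\\hline -2^{m+2d}&2^{n-1}+2^{m+2d-1}&\dfrac{2^{m-2d-1}(2^{m-2d}-1)(2^{m-d}-1)(2^n-1)}{(2^d+1)(2^{2d}-1)}\\\hline 0&2^{n-1}&\begin{array}{c}(2^n-1)\bigl(2^{3m-d}-2^{3m-2d}+2^{3m-3d}-2^{3m-4d}+2^{3m-5d}\\{}+2^{n-d}-2^{n-2d+1}+2^{n-3d}-2^{n-4d}+1\bigr)\end{array}\\\hline 2^n&0&1\\\hline \end{array}\] -/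

import Mathlib

open Polynomial

noncomputable section

namespace GenKasami

/-- The subfield of `F` formed by the roots of `x ^ (2 ^ m) = x`; when `F` has `2 ^ (2 * m)` elements
this is the subfield of order `2 ^ m`. -/
def subfieldPow (F : Type*) [Field F] [Algebra (ZMod 2) F] (m : ℕ) :
    IntermediateField (ZMod 2) F where
  carrier := {x | x ^ 2 ^ m = x}
  mul_mem' := by
    intro a b ha hb
    simp only [Set.mem_ofPred_eq] at *
    rw [mul_pow, ha, hb]
  one_mem' := by simp
  add_mem' := by
    intro a b ha hb
    have : CharP F 2 := charP_of_injective_algebraMap (algebraMap (ZMod 2) F).injective 2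
    simp only [Set.mem_ofPred_eq] at *
    rw [add_pow_char_pow, ha, hb]
  zero_mem' := by simp
  algebraMap_mem' := by
    intro r
    simp only [Set.mem_ofPred_eq]
    rw [← map_pow, ZMod.pow_card_pow]
  inv_mem' := by
    intro a ha
    simp only [Set.mem_ofPred_eq] at *
    rw [inv_pow, ha]

section Sums

variable {F : Type*} [Field F] [Fintype F] [Algebra (ZMod 2) F] {n m : ℕ}

/-- `x ^ (2 ^ m + 1)` as an element of the subfield of order `2 ^ m`. -/
def powElt (hn : n = 2 * m) (hF : Fintype.card F = 2 ^ n) (x : F) : subfieldPow F m :=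
  ⟨x ^ (2 ^ m + 1), by
    change (x ^ (2 ^ m + 1)) ^ 2 ^ m = x ^ (2 ^ m + 1)
    have h : x ^ (2 ^ m * 2 ^ m) = x := by
      have h1 := FiniteField.pow_card x
      rwa [hF, hn, two_mul, pow_add] at h1
    rw [← pow_mul, add_mul, one_mul, pow_add, h, pow_succ, mul_comm]⟩

/-- `Tr_1^m (α x ^ (2 ^ m + 1)) + Tr_1^n (β x ^ (2 ^ k + 1) + γ x)`, an element of the prime field. -/
def phase (hn : n = 2 * m) (hF : Fintype.card F = 2 ^ n) (k : ℕ)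
    (α : subfieldPow F m) (β γ : F) (x : F) : ZMod 2 :=
  Algebra.trace (ZMod 2) (subfieldPow F m) (α * powElt hn hF x) +
    Algebra.trace (ZMod 2) F (β * x ^ (2 ^ k + 1) + γ * x)

/-- The exponential sum `S(α, β, γ)`. -/
def expSum (hn : n = 2 * m) (hF : Fintype.card F = 2 ^ n) (k : ℕ)
    (α : subfieldPow F m) (β γ : F) : ℤ :=
  ∑ x : F, (-1) ^ (phase hn hF k α β γ x).val

/-- The word `c(α, β, γ)` of length `q - 1`, whose `i`-th entry is
`Tr_1^m (α π ^ (i (2 ^ m + 1))) + Tr_1^n (β π ^ (i (2 ^ k + 1)) + γ π ^ i)`. -/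
def word (hn : n = 2 * m) (hF : Fintype.card F = 2 ^ n) (k : ℕ) (π : F)
    (α : subfieldPow F m) (β γ : F) : Fin (2 ^ n - 1) → ZMod 2 :=
  fun i => phase hn hF k α β γ (π ^ (i : ℕ))

end Sums

/-- The polynomial `c_0 + c_1 X + ... + c_(l-1) X ^ (l-1)` of a binary word of length `l`. -/
def wordPoly {l : ℕ} (c : Fin l → ZMod 2) : (ZMod 2)[X] :=
  ∑ i : Fin l, C (c i) * X ^ (i : ℕ)

/-- The binary cyclic code of length `l` with parity-check polynomial `h` (a divisor of `X ^ l - 1`):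
the words `c` with `h(X) c(X) = 0` modulo `X ^ l - 1`. -/
def cyclicCode (l : ℕ) (h : (ZMod 2)[X]) : Submodule (ZMod 2) (Fin l → ZMod 2) where
  carrier := {c | (X ^ l - 1 : (ZMod 2)[X]) ∣ h * wordPoly c}
  zero_mem' := by simp [wordPoly]
  add_mem' := by
    intro a b ha hb
    have h1 : wordPoly (a + b) = wordPoly a + wordPoly b := by
      simp [wordPoly, add_mul, Finset.sum_add_distrib]
    simp only [Set.mem_ofPred_eq] at *
    rw [h1, mul_add]
    exact dvd_add ha hb
  smul_mem' := by
    intro r a ha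
    have h1 : wordPoly (r • a) = C r * wordPoly a := by
      simp [wordPoly, Finset.mul_sum, mul_assoc]
    simp only [Set.mem_ofPred_eq] at *
    rw [h1, mul_left_comm]
    exact Dvd.dvd.mul_left ha _

/-- For a divisor `h` of `X ^ l - 1`, the code is generated by `g = (X ^ l - 1) / h`. -/
theorem mem_cyclicCode_iff {l : ℕ} {g h : (ZMod 2)[X]} (hh : h ≠ 0)
    (hgh : h * g = X ^ l - 1) (c : Fin l → ZMod 2) :
    c ∈ cyclicCode l h ↔ g ∣ wordPoly c := by
  change (X ^ l - 1 : (ZMod 2)[X]) ∣ h * wordPoly c ↔ _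
  rw [← hgh, mul_dvd_mul_iff_left hh]

/-- The code `C₂` of length `2 ^ n - 1` with parity-check polynomial `h₁ h₂ h₃`, where `h₁`, `h₂`, `h₃`
are the minimal polynomials of `π⁻¹`, `π ^ (-(2 ^ k + 1))`, `π ^ (-(2 ^ m + 1))`. -/
def codeC2 {F : Type*} [Field F] [Algebra (ZMod 2) F] (n m k : ℕ) (π : F) :
    Submodule (ZMod 2) (Fin (2 ^ n - 1) → ZMod 2) :=
  cyclicCode (2 ^ n - 1)
    (minpoly (ZMod 2) π⁻¹ * minpoly (ZMod 2) (π ^ (2 ^ k + 1))⁻¹ *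
      minpoly (ZMod 2) (π ^ (2 ^ m + 1))⁻¹)

/-- A row of a distribution table: a value of the exponential sum, the Hamming weight of the
corresponding words, and the multiplicity. -/
structure Row where
  value : ℚ
  weight : ℚ
  mult : ℚ

/-- The table for `d' = d`. The exponents are integers, so no subtraction is truncated. -/
def tableOne (n m d : ℤ) : List Row :=
  [ ⟨2 ^ m, 2 ^ (n - 1) - 2 ^ (m - 1),
      2 ^ (m - 1) * (2 ^ n - 1) *
        (2 ^ (n + 2 * d) - 2 ^ (n + d) - 2 ^ n + 2 ^ (m + 2 * d) - 2 ^ (m + d) + 2 ^ (2 * d)) /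
        (2 ^ (2 * d) - 1)⟩,
    ⟨-2 ^ m, 2 ^ (n - 1) + 2 ^ (m - 1),
      2 ^ (m - 1) * (2 ^ m - 1) ^ 2 *
        (2 ^ (n + 2 * d) - 2 ^ (n + d) - 2 ^ n + 2 ^ (m + 2 * d) - 2 ^ (m + d) + 2 ^ (2 * d)) /
        (2 ^ (2 * d) - 1)⟩,
    ⟨2 ^ (m + d), 2 ^ (n - 1) - 2 ^ (m + d - 1),
      2 ^ (m - d - 1) * (2 ^ (m - d) + 1) * (2 ^ (m + d) - 1) * (2 ^ n - 1) /
        (2 ^ (2 * d) - 1)⟩,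
    ⟨-2 ^ (m + d), 2 ^ (n - 1) + 2 ^ (m + d - 1),
      2 ^ (m - d - 1) * (2 ^ (m - d) - 1) * (2 ^ (m + d) - 1) * (2 ^ n - 1) /
        (2 ^ (2 * d) - 1)⟩,
    ⟨0, 2 ^ (n - 1), (2 ^ (3 * m - d) - 2 ^ (n - 2 * d) + 1) * (2 ^ n - 1)⟩,
    ⟨2 ^ n, 0, 1⟩ ]

/-- The table for `d' = 2 d`. -/
def tableTwo (n m d : ℤ) : List Row :=
  [ ⟨2 ^ m, 2 ^ (n - 1) - 2 ^ (m - 1),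
      2 ^ (m + 3 * d - 1) * (2 ^ n - 1) *
        (2 ^ n - 2 ^ (n - 2 * d) - 2 ^ (n - 3 * d) + 2 ^ m - 2 ^ (m - d) + 1) /
        ((2 ^ d + 1) * (2 ^ (2 * d) - 1))⟩,
    ⟨-2 ^ m, 2 ^ (n - 1) + 2 ^ (m - 1),
      2 ^ (m + 3 * d - 1) * (2 ^ m - 1) ^ 2 *
        (2 ^ n - 2 ^ (n - 2 * d) - 2 ^ (n - 3 * d) + 2 ^ m - 2 ^ (m - d) + 1) /
        ((2 ^ d + 1) * (2 ^ (2 * d) - 1))⟩,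
    ⟨2 ^ (m + d), 2 ^ (n - 1) - 2 ^ (m + d - 1),
      2 ^ (m - 1) * (2 ^ (m - d) + 1) * (2 ^ n - 1) *
        (2 ^ m + 2 ^ (m - d) + 2 ^ (m - 2 * d) + 1) / (2 ^ d + 1) ^ 2⟩,
    ⟨-2 ^ (m + d), 2 ^ (n - 1) + 2 ^ (m + d - 1),
      2 ^ (m - 1) * (2 ^ (m - d) - 1) * (2 ^ n - 1) *
        (2 ^ m + 2 ^ (m - d) + 2 ^ (m - 2 * d) + 1) / (2 ^ d + 1) ^ 2⟩,
    ⟨2 ^ (m + 2 * d), 2 ^ (n - 1) - 2 ^ (m + 2 * d - 1),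
      2 ^ (m - 2 * d - 1) * (2 ^ (m - 2 * d) + 1) * (2 ^ (m - d) - 1) * (2 ^ n - 1) /
        ((2 ^ d + 1) * (2 ^ (2 * d) - 1))⟩,
    ⟨-2 ^ (m + 2 * d), 2 ^ (n - 1) + 2 ^ (m + 2 * d - 1),
      2 ^ (m - 2 * d - 1) * (2 ^ (m - 2 * d) - 1) * (2 ^ (m - d) - 1) * (2 ^ n - 1) /
        ((2 ^ d + 1) * (2 ^ (2 * d) - 1))⟩,
    ⟨0, 2 ^ (n - 1),
      (2 ^ n - 1) *
        (2 ^ (3 * m - d) - 2 ^ (3 * m - 2 * d) + 2 ^ (3 * m - 3 * d) - 2 ^ (3 * m - 4 * d) +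
          2 ^ (3 * m - 5 * d) + 2 ^ (n - d) - 2 ^ (n - 2 * d + 1) + 2 ^ (n - 3 * d) -
          2 ^ (n - 4 * d) + 1)⟩,
    ⟨2 ^ n, 0, 1⟩ ]

/-- The table `t` is the complete value distribution of `S(α, β, γ)`, with the weights of the words
`c(α, β, γ)`, and the complete weight distribution of `C₂`. -/
structure IsDistribution {F : Type*} [Field F] [Fintype F] [Algebra (ZMod 2) F] {n m : ℕ}
    (hn : n = 2 * m) (hF : Fintype.card F = 2 ^ n) (k : ℕ) (π : F) (t : List Row) : Prop where
  /-- Every triple belongs to a row: its sum and the weight of its word are those of the row. -/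
  complete : ∀ (α : subfieldPow F m) (β γ : F), ∃ r ∈ t,
    (expSum hn hF k α β γ : ℚ) = r.value ∧
      (hammingNorm (word hn hF k π α β γ) : ℚ) = r.weight
  /-- The number of triples with a given value of the sum. -/
  value_mult : ∀ r ∈ t,
    (Nat.card {p : subfieldPow F m × F × F //
      (expSum hn hF k p.1 p.2.1 p.2.2 : ℚ) = r.value} : ℚ) = r.mult
  /-- Every weight of a codeword is listed. -/
  code_complete : ∀ c ∈ codeC2 n m k π, ∃ r ∈ t, (hammingNorm c : ℚ) = r.weight
  /-- The number of codewords with a given weight. -/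
  weight_mult : ∀ r ∈ t,
    (Nat.card {c : codeC2 n m k π //
      (hammingNorm (c : Fin (2 ^ n - 1) → ZMod 2) : ℚ) = r.weight} : ℚ) = r.mult

end GenKasami

end

noncomputable section

namespace GenKasami

/-! For fixed α, β the exponent in S is a quadratic form over F₂ plus the linear term Tr(γx). Its
polarization is Tr(x φ(y)), with φ = `polarMap`, and R = ker φ is the `radical`. Squaring S gives S²
= 2^n |R| or S = 0 (`expSum_sq`). If |R| = 2^(2j), then S takes only the values ±2^(m+j) and 0. The
moments ∑_γ S = 2^n and ∑_γ S² = 2^(2n) then fix how often each value occurs as γ varies. What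
remains is to count, for each j, the pairs (α, β) with |R| = 2^(2j).

Let K be the fixed field of σ : x ↦ x^(2^(m+k)), so |K| = 2^d'. The map φ is K-semilinear, so R is a
K-space. Its elements solve a second order σ-linear equation, so dim_K R ≤ 2 unless α = β = 0
(`card_radical_le`). Counting the triples (α, β, y) with y in R gives the mean of |R|
(`sum_card_radical`).

If d' = d, then K lies in the field of order 2^m and a self-orthogonal K-subspace forces dim_K R to
be even (`card_mul_card_radical`). The two unknown counts follow from the total and the mean. If d'
= 2d, there are three unknowns. The third equation is ∑ S(α, β, 0) = 2^(3m), where the signs are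
known because S(α, β, 0) ≡ 1 modulo 2^d + 1 (`expSum_zero_modEq`).

For the code, the trace words satisfy the parity checks, and the degrees of the minimal polynomials
bound the code by 2^(5m). The words are distinct because a vanishing form would have radical F, of
size more than |K|². Hence the words fill the code. Weights come from S = 2^n − 2·weight. -/

theorem charP_two (F : Type*) [Field F] [Algebra (ZMod 2) F] : CharP F 2 :=
  charP_of_injective_algebraMap (algebraMap (ZMod 2) F).injective 2

/-! ### Signs of elements of F₂ and vanishing of character sums. -/

section Sign

/-- The sign `(-1) ^ v` of an element of the prime field. -/
def sgn (v : ZMod 2) : ℤ := (-1) ^ v.val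

theorem sgn_zero : sgn 0 = 1 := by decide

theorem sgn_add : ∀ u v : ZMod 2, sgn (u + v) = sgn u * sgn v := by decide

theorem sgn_of_ne_zero : ∀ v : ZMod 2, v ≠ 0 → sgn v = -1 := by decide

theorem sum_sgn_hom_eq_zero {G : Type*} [AddGroup G] [Fintype G] (f : G →+ ZMod 2)
    (h : ∃ g, f g ≠ 0) : ∑ g, sgn (f g) = 0 := by
  obtain ⟨a, ha⟩ := h
  have h1 : ∑ g, sgn (f (a + g)) = ∑ g, sgn (f g) :=
    Fintype.sum_equiv (Equiv.addLeft a) _ _ fun _ => rfl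
  have h2 : ∑ g, sgn (f (a + g)) = - ∑ g, sgn (f g) := by
    rw [← Finset.sum_neg_distrib]
    refine Finset.sum_congr rfl fun g _ => ?_
    rw [map_add, sgn_add, sgn_of_ne_zero _ ha]
    ring
  linarith

end Sign

/-! ### The absolute trace: nondegeneracy, Frobenius invariance, orthogonality. -/

section Trace

variable {F : Type*} [Field F] [Finite F] [Algebra (ZMod 2) F]

theorem exists_trace_mul_ne_zero {a : F} (ha : a ≠ 0) :
    ∃ b : F, Algebra.trace (ZMod 2) F (a * b) ≠ 0 := by
  have htr := (traceForm_nondegenerate (ZMod 2) F).1 a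
  simp_rw [Algebra.traceForm_apply] at htr
  by_contra! hf
  exact ha (htr hf)

theorem trace_pow_two_pow (x : F) (i : ℕ) :
    Algebra.trace (ZMod 2) F (x ^ 2 ^ i) = Algebra.trace (ZMod 2) F x := by
  induction i with
  | zero => simp
  | succ i ih =>
    have := Algebra.trace_eq_of_algEquiv
      (FiniteField.frobeniusAlgEquivOfAlgebraic (ZMod 2) F) (x ^ 2 ^ i)
    rw [FiniteField.coe_frobeniusAlgEquivOfAlgebraic] at this
    simp only [ZMod.card, ← pow_mul, ← pow_succ] at this
    rw [this, ih]

theorem sum_sgn_trace_mul [Fintype F] [DecidableEq F] (a : F) :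
    ∑ x : F, sgn (Algebra.trace (ZMod 2) F (a * x)) =
      if a = 0 then (Fintype.card F : ℤ) else 0 := by
  split_ifs with h
  · simp [h, sgn_zero]
  · exact sum_sgn_hom_eq_zero
      ((Algebra.trace (ZMod 2) F).toAddMonoidHom.comp (AddMonoidHom.mulLeft a))
      (exists_trace_mul_ne_zero h)

end Trace

/-! ### Subfields as fixed points of powers of Frobenius. -/

section Subfields

variable {F : Type*} [Field F] [Algebra (ZMod 2) F]

theorem mem_subfieldPow {a : ℕ} {x : F} : x ∈ subfieldPow F a ↔ x ^ 2 ^ a = x := Iff.rfl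

/-- Periods of a point under squaring are closed under gcd and multiples, which yields intersections
and inclusions of these subfields. -/
theorem mem_subfieldPow_iff_isPeriodicPt {a : ℕ} {x : F} :
    x ∈ subfieldPow F a ↔ Function.IsPeriodicPt (fun y : F => y ^ 2) a x := by
  rw [mem_subfieldPow, Function.IsPeriodicPt, Function.IsFixedPt, pow_iterate]

theorem mem_subfieldPow_gcd {a b : ℕ} {x : F} (ha : x ∈ subfieldPow F a)
    (hb : x ∈ subfieldPow F b) : x ∈ subfieldPow F (a.gcd b) := by
  rw [mem_subfieldPow_iff_isPeriodicPt] at *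
  exact ha.gcd hb

theorem subfieldPow_mono {a b : ℕ} (h : a ∣ b) {x : F} (hx : x ∈ subfieldPow F a) :
    x ∈ subfieldPow F b := by
  rw [mem_subfieldPow_iff_isPeriodicPt] at *
  exact hx.trans_dvd h

theorem add_pow_two_pow (x y : F) (i : ℕ) : (x + y) ^ 2 ^ i = x ^ 2 ^ i + y ^ 2 ^ i := by
  have := charP_two F
  exact add_pow_char_pow x y 2 i

theorem pow_two_pow_injective (i : ℕ) : Function.Injective fun x : F => x ^ 2 ^ i := by
  have := charP_two F
  exact iterateFrobenius_inj F 2 i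

variable [Fintype F] {n : ℕ} (hF : Fintype.card F = 2 ^ n)
include hF

theorem pow_two_pow_card (x : F) : x ^ 2 ^ n = x := by
  rw [← hF, FiniteField.pow_card]

/-- The nonzero elements are the solutions of u^(2^a − 1) = 1 in the cyclic group Fˣ, and gcd(2^n −
1, 2^a − 1) = 2^gcd(n, a) − 1. -/
theorem card_subfieldPow (a : ℕ) : Nat.card (subfieldPow F a) = 2 ^ n.gcd a := by
  have h1 : Nat.card (subfieldPow F a)ˣ = Nat.card (powMonoidHom (2 ^ a - 1) : Fˣ →* Fˣ).ker := by
    have key : ∀ u : Fˣ, u ^ (2 ^ a - 1) = 1 ↔ (u : F) ∈ subfieldPow F a := by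
      intro u
      rw [mem_subfieldPow, Units.ext_iff, Units.val_pow_eq_pow_val, Units.val_one]
      conv_rhs => rw [← Nat.sub_add_cancel (Nat.one_le_two_pow (n := a)), pow_succ]
      exact (mul_eq_right₀ u.ne_zero).symm
    refine Nat.card_congr (Equiv.ofBijective
      (fun u => ⟨Units.map (subfieldPow F a).val.toRingHom.toMonoidHom u, ?_⟩) ⟨?_, ?_⟩)
    · rw [MonoidHom.mem_ker, powMonoidHom_apply, key]
      exact (u : subfieldPow F a).2
    · intro u v h
      have := congrArg (fun w => ((w : Fˣ) : F)) (Subtype.ext_iff.1 h)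
      exact Units.ext (Subtype.ext this)
    · rintro ⟨u, hu⟩
      rw [MonoidHom.mem_ker, powMonoidHom_apply, key] at hu
      refine ⟨Units.mk0 ⟨u, hu⟩ fun h => u.ne_zero (congrArg Subtype.val h), ?_⟩
      exact Subtype.ext (Units.ext rfl)
  have h2 : Nat.card Fˣ = 2 ^ n - 1 := by rw [Nat.card_units, Nat.card_eq_fintype_card, hF]
  rw [IsCyclic.card_powMonoidHom_ker, h2, Nat.pow_sub_one_gcd_pow_sub_one, Nat.card_units] at h1
  have h3 : 0 < Nat.card (subfieldPow F a) := Nat.card_pos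
  have := Nat.one_le_two_pow (n := n.gcd a)
  omega

end Subfields

/-! ### The trace from F to the subfield of order 2^m. -/

section RelativeTrace

variable {F : Type*} [Field F] [Fintype F] [Algebra (ZMod 2) F] {n m : ℕ}
  (hn : n = 2 * m) (hF : Fintype.card F = 2 ^ n)

include hn hF in
theorem pow_two_pow_half (x : F) : (x ^ 2 ^ m) ^ 2 ^ m = x := by
  rw [← pow_mul, ← pow_add, ← two_mul, ← hn, pow_two_pow_card hF]

/-- The relative trace `z ↦ z + z ^ (2 ^ m)`, with values in the subfield of order `2 ^ m`. -/
def relTrace : F →+ subfieldPow F m where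
  toFun z := ⟨z + z ^ 2 ^ m, by
    rw [mem_subfieldPow, add_pow_two_pow, pow_two_pow_half hn hF, add_comm]⟩
  map_zero' := Subtype.ext <| by simp
  map_add' x y := Subtype.ext <| by
    change x + y + (x + y) ^ 2 ^ m = (x + x ^ 2 ^ m) + (y + y ^ 2 ^ m)
    rw [add_pow_two_pow]
    ring

theorem coe_relTrace (z : F) : (relTrace hn hF z : F) = z + z ^ 2 ^ m := rfl

include hn hF in
theorem card_subfieldPow_half : Nat.card (subfieldPow F m) = 2 ^ m := by
  rw [card_subfieldPow hF, hn, Nat.gcd_eq_right (Dvd.intro_left 2 rfl)]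

include hn hF in
theorem card_eq_sq : Nat.card F = 2 ^ m * 2 ^ m := by
  rw [Nat.card_eq_fintype_card, hF, hn, two_mul, pow_add]

theorem mem_ker_relTrace {z : F} : z ∈ (relTrace hn hF).ker ↔ z ∈ subfieldPow F m := by
  have := charP_two F
  rw [AddMonoidHom.mem_ker, mem_subfieldPow, Subtype.ext_iff, coe_relTrace, ZeroMemClass.coe_zero,
    CharTwo.add_eq_zero, eq_comm]

theorem card_ker_relTrace : Nat.card (relTrace hn hF).ker = 2 ^ m := by
  rw [← card_subfieldPow_half hn hF]
  exact Nat.card_congr (Equiv.subtypeEquivRight fun z => mem_ker_relTrace hn hF)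

theorem relTrace_surjective : Function.Surjective (relTrace hn hF) := by
  have h := (relTrace hn hF).ker.card_mul_index
  rw [AddSubgroup.index_ker, card_ker_relTrace, card_eq_sq hn hF] at h
  have h := Nat.eq_of_mul_eq_mul_left (by positivity) h
  rw [← AddMonoidHom.range_eq_top, ← AddSubgroup.card_eq_iff_eq_top, h,
    card_subfieldPow_half hn hF]

theorem card_preimage_relTrace (H : AddSubgroup (subfieldPow F m)) :
    Nat.card (H.comap (relTrace hn hF)) = 2 ^ m * Nat.card H := by
  have h1 := (H.comap (relTrace hn hF)).card_mul_index
  rw [AddSubgroup.index_comap_of_surjective _ (relTrace_surjective hn hF)] at h1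
  have h2 := H.card_mul_index
  rw [card_subfieldPow_half hn hF] at h2
  rw [card_eq_sq hn hF, ← h2] at h1
  have h3 : 0 < H.index := Nat.pos_of_ne_zero (by
    intro h
    rw [h, mul_zero] at h2
    exact absurd h2.symm (by positivity))
  have h4 : Nat.card H * H.index * (Nat.card H * H.index) =
    (Nat.card H * H.index) * Nat.card H * H.index := by ring
  rw [h4] at h1
  rw [Nat.eq_of_mul_eq_mul_right h3 h1, h2]

include hn hF in
theorem finrank_eq : Module.finrank (ZMod 2) F = m + m := by
  have := Module.natCard_eq_pow_finrank (K := ZMod 2) (V := F)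
  rw [Nat.card_zmod, card_eq_sq hn hF, ← pow_add] at this
  exact (Nat.pow_right_injective le_rfl this).symm

include hn hF in
theorem finrank_subfieldPow_half : Module.finrank (ZMod 2) (subfieldPow F m) = m := by
  have := Module.natCard_eq_pow_finrank (K := ZMod 2) (V := subfieldPow F m)
  rw [Nat.card_zmod, card_subfieldPow_half hn hF] at this
  exact (Nat.pow_right_injective le_rfl this).symm

theorem trace_relTrace (z : F) :
    Algebra.trace (ZMod 2) (subfieldPow F m) (relTrace hn hF z) =
      Algebra.trace (ZMod 2) F z := by
  apply (algebraMap (ZMod 2) F).injective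
  rw [FiniteField.algebraMap_trace_eq_sum_pow, finrank_eq hn hF,
    IsScalarTower.algebraMap_apply (ZMod 2) (subfieldPow F m) F,
    FiniteField.algebraMap_trace_eq_sum_pow, finrank_subfieldPow_half hn hF, map_sum,
    Finset.sum_range_add, ← Finset.sum_add_distrib]
  -- The 2m conjugates of z are paired as i and i + m.
  refine Finset.sum_congr rfl fun i _ => ?_
  rw [Nat.card_zmod, map_pow]
  change (z + z ^ 2 ^ m) ^ 2 ^ i = _
  rw [add_pow_two_pow, ← pow_mul, ← pow_add]

theorem trace_mul_relTrace (α : subfieldPow F m) (z : F) :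
    Algebra.trace (ZMod 2) (subfieldPow F m) (α * relTrace hn hF z) =
      Algebra.trace (ZMod 2) F (α * z) := by
  rw [← trace_relTrace hn hF]
  congr 1
  apply Subtype.ext
  change (α : F) * (z + z ^ 2 ^ m) = α * z + (α * z) ^ 2 ^ m
  rw [mul_pow, mem_subfieldPow.1 α.2, mul_add]

end RelativeTrace

/-! ### The quadratic form, its polarization, and the moments of S in γ. -/

section Phase

variable {F : Type*} [Field F] [Fintype F] [Algebra (ZMod 2) F] {n m : ℕ}
  (hn : n = 2 * m) (hF : Fintype.card F = 2 ^ n)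

/-- The additive map `φ` with `phase (x + y) = phase x + phase y + Tr (x φ(y))`. -/
def polarMap (n k : ℕ) (α : subfieldPow F m) (β : F) : F →+ F where
  toFun y := α * y ^ 2 ^ m + β * y ^ 2 ^ k + (β * y) ^ 2 ^ (n - k)
  map_zero' := by simp
  map_add' x y := by
    simp only [mul_add, add_pow_two_pow]
    ring

theorem polarMap_apply (n k : ℕ) (α : subfieldPow F m) (β y : F) :
    polarMap n k α β y = α * y ^ 2 ^ m + β * y ^ 2 ^ k + (β * y) ^ 2 ^ (n - k) := rfl

/-- The radical of the polarization of the quadratic form `x ↦ phase α β 0 x`. -/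
def radical (n k : ℕ) (α : subfieldPow F m) (β : F) : AddSubgroup F := (polarMap n k α β).ker

theorem mem_radical {n k : ℕ} {α : subfieldPow F m} {β y : F} :
    y ∈ radical n k α β ↔ polarMap n k α β y = 0 := Iff.rfl

theorem powElt_add (x y : F) :
    powElt hn hF (x + y) = powElt hn hF x + powElt hn hF y + relTrace hn hF (x * y ^ 2 ^ m) := by
  apply Subtype.ext
  change (x + y) ^ (2 ^ m + 1) = x ^ (2 ^ m + 1) + y ^ (2 ^ m + 1) +
    (x * y ^ 2 ^ m + (x * y ^ 2 ^ m) ^ 2 ^ m)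
  rw [pow_succ, add_pow_two_pow, mul_pow, pow_two_pow_half hn hF]
  ring

include hF in
-- The trace is Frobenius invariant, so the adjoint of the 2^k-th power is the 2^(n−k)-th power.
-- This is the source of the last term of `polarMap`.
theorem trace_mul_pow_two_pow {k : ℕ} (hk : k ≤ n) (β x y : F) :
    Algebra.trace (ZMod 2) F (β * (x ^ 2 ^ k * y)) =
      Algebra.trace (ZMod 2) F (x * (β * y) ^ 2 ^ (n - k)) := by
  rw [← trace_pow_two_pow (β * (x ^ 2 ^ k * y)) (n - k)]
  congr 1
  have h : (x ^ 2 ^ k) ^ 2 ^ (n - k) = x := by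
    rw [← pow_mul, ← pow_add, Nat.add_sub_cancel' hk, pow_two_pow_card hF]
  rw [mul_left_comm, mul_pow, h]

theorem phase_add {k : ℕ} (hk : k ≤ n) (α : subfieldPow F m) (β γ x y : F) :
    phase hn hF k α β γ (x + y) = phase hn hF k α β γ x + phase hn hF k α β γ y +
      Algebra.trace (ZMod 2) F (x * polarMap n k α β y) := by
  have h1 : β * (x + y) ^ (2 ^ k + 1) + γ * (x + y) =
      (β * x ^ (2 ^ k + 1) + γ * x) + (β * y ^ (2 ^ k + 1) + γ * y) +
        (x * (β * y ^ 2 ^ k) + β * (x ^ 2 ^ k * y)) := by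
    rw [pow_succ, add_pow_two_pow]
    ring
  simp only [phase, powElt_add hn hF, polarMap_apply, h1]
  simp only [mul_add, map_add, trace_mul_relTrace, trace_mul_pow_two_pow hF hk]
  rw [mul_left_comm (α : F) x]
  ring

theorem phase_zero (k : ℕ) (α : subfieldPow F m) (β γ : F) : phase hn hF k α β γ 0 = 0 := by
  have h : powElt hn hF (0 : F) = 0 := Subtype.ext (zero_pow (Nat.succ_ne_zero _))
  simp [phase, h]

theorem phase_triple_add (k : ℕ) (α α' : subfieldPow F m) (β β' γ γ' x : F) :
    phase hn hF k (α + α') (β + β') (γ + γ') x =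
      phase hn hF k α β γ x + phase hn hF k α' β' γ' x := by
  simp only [phase, add_mul, map_add]
  ring

theorem phase_eq_add_trace (k : ℕ) (α : subfieldPow F m) (β γ x : F) :
    phase hn hF k α β γ x = phase hn hF k α β 0 x + Algebra.trace (ZMod 2) F (x * γ) := by
  simp only [phase, zero_mul, add_zero, map_add, mul_comm x γ]
  ring

theorem expSum_eq (k : ℕ) (α : subfieldPow F m) (β γ : F) :
    expSum hn hF k α β γ = ∑ x, sgn (phase hn hF k α β γ x) := rfl

-- Substituting y = x + z in the double sum makes the summand linear in x. The sum over x then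
-- vanishes unless z is in the radical.
open Classical in
theorem expSum_sq_eq_sum {k : ℕ} (hk : k ≤ n) (α : subfieldPow F m) (β γ : F) :
    expSum hn hF k α β γ ^ 2 =
      2 ^ n * ∑ z : radical n k α β, sgn (phase hn hF k α β γ z) := by
  rw [sq, expSum_eq, Finset.sum_mul_sum]
  have h1 : ∀ x : F, ∑ y, sgn (phase hn hF k α β γ x) * sgn (phase hn hF k α β γ y) =
      ∑ z, sgn (phase hn hF k α β γ z) *
        sgn (Algebra.trace (ZMod 2) F (polarMap n k α β z * x)) := by
    intro x
    rw [← Equiv.sum_comp (Equiv.addLeft x)]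
    refine Finset.sum_congr rfl fun z _ => ?_
    rw [Equiv.coe_addLeft, phase_add hn hF hk, ← sgn_add, ← sgn_add,
      mul_comm x (polarMap n k α β z)]
    congr 1
    rw [← add_assoc, ← add_assoc, CharTwo.add_self_eq_zero, zero_add]
  rw [Finset.sum_congr rfl fun x _ => h1 x, Finset.sum_comm]
  simp_rw [← Finset.mul_sum, sum_sgn_trace_mul, mul_ite, mul_zero]
  rw [← Finset.sum_filter, Finset.mul_sum,
    ← Finset.sum_subtype (Finset.univ.filter fun z => polarMap n k α β z = 0)
      (fun z => by simp [mem_radical])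
      (fun z => 2 ^ n * sgn (phase hn hF k α β γ z))]
  refine Finset.sum_congr rfl fun z _ => ?_
  rw [hF, mul_comm]
  norm_cast

/-- On the radical the phase is additive, so its signs either sum to zero or are all 1. -/
theorem expSum_sq {k : ℕ} (hk : k ≤ n) (α : subfieldPow F m) (β γ : F) :
    expSum hn hF k α β γ ^ 2 = 2 ^ n * Nat.card (radical n k α β) ∨
      expSum hn hF k α β γ = 0 := by
  classical
  let f : radical n k α β →+ ZMod 2 :=
    { toFun := fun z => phase hn hF k α β γ z
      map_zero' := phase_zero hn hF k α β γ
      map_add' := fun x y => by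
        rw [AddSubgroup.coe_add, phase_add hn hF hk, mem_radical.1 y.2, mul_zero, map_zero,
          add_zero] }
  have h := expSum_sq_eq_sum hn hF hk α β γ
  by_cases hf : ∃ z, f z ≠ 0
  · right
    have h2 : ∑ z : radical n k α β, sgn (phase hn hF k α β γ z) = 0 :=
      sum_sgn_hom_eq_zero f hf
    rw [h2, mul_zero] at h
    exact pow_eq_zero_iff (two_ne_zero) |>.1 h
  · left
    push Not at hf
    have h2 : ∀ z : radical n k α β, sgn (phase hn hF k α β γ z) = 1 := fun z => by
      rw [show phase hn hF k α β γ z = 0 from hf z, sgn_zero]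
    simp only [h2, Finset.sum_const, Finset.card_univ, ← Nat.card_eq_fintype_card,
      nsmul_eq_mul, mul_one] at h
    exact h

theorem sum_sgn_phase (k : ℕ) (α : subfieldPow F m) (β x : F) [Decidable (x = 0)] :
    ∑ γ, sgn (phase hn hF k α β γ x) = if x = 0 then 2 ^ n else 0 := by
  classical
  rw [Finset.sum_congr rfl fun γ _ => by rw [phase_eq_add_trace, sgn_add], ← Finset.mul_sum,
    sum_sgn_trace_mul]
  split_ifs with h
  · rw [h, phase_zero, sgn_zero, hF]
    norm_cast
    rw [one_mul]
  · simp

theorem sum_expSum (k : ℕ) (α : subfieldPow F m) (β : F) :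
    ∑ γ, expSum hn hF k α β γ = 2 ^ n := by
  classical
  simp_rw [expSum_eq]
  rw [Finset.sum_comm]
  simp_rw [sum_sgn_phase]
  simp

theorem sum_expSum_sq {k : ℕ} (hk : k ≤ n) (α : subfieldPow F m) (β : F) :
    ∑ γ, expSum hn hF k α β γ ^ 2 = 2 ^ n * 2 ^ n := by
  classical
  simp_rw [expSum_sq_eq_sum hn hF hk, ← Finset.mul_sum]
  rw [Finset.sum_comm]
  simp_rw [sum_sgn_phase]
  simp

end Phase

/-- The first moment gives the difference of the counts of s and −s, the second gives their sum. -/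
theorem card_of_values {G : Type*} [Fintype G] (f : G → ℤ) {s : ℤ} (hs : s ≠ 0)
    (hf : ∀ g, f g = s ∨ f g = -s ∨ f g = 0) {a b : ℤ}
    (h1 : ∑ g, f g = s * a) (h2 : ∑ g, f g ^ 2 = s ^ 2 * b) :
    2 * (Nat.card {g // f g = s} : ℤ) = b + a ∧ 2 * (Nat.card {g // f g = -s} : ℤ) = b - a ∧
      (Nat.card {g // f g = 0} : ℤ) = Nat.card G - b := by
  classical
  have hs2 : s ≠ -s := by omega
  have c : ∀ v : ℤ, (Nat.card {g // f g = v} : ℤ) = ∑ g, if f g = v then 1 else 0 := by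
    intro v
    rw [Nat.card_eq_fintype_card, Fintype.card_subtype, Finset.card_filter]
    push_cast
    rfl
  have e0 : (Nat.card G : ℤ) = ∑ _g : G, 1 := by simp
  have e1 : ∑ g, f g = s * (Nat.card {g // f g = s} - Nat.card {g // f g = -s}) := by
    rw [c, c, ← Finset.sum_sub_distrib, Finset.mul_sum]
    refine Finset.sum_congr rfl fun g _ => ?_
    rcases hf g with h | h | h <;> simp [h, hs, hs.symm, hs2, hs2.symm]
  have e2 : ∑ g, f g ^ 2 = s ^ 2 * (Nat.card {g // f g = s} + Nat.card {g // f g = -s}) := by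
    rw [c, c, ← Finset.sum_add_distrib, Finset.mul_sum]
    refine Finset.sum_congr rfl fun g _ => ?_
    rcases hf g with h | h | h <;> simp [h, hs, hs.symm, hs2, hs2.symm]
  have e3 : (Nat.card G : ℤ) = Nat.card {g // f g = s} + Nat.card {g // f g = -s} +
      Nat.card {g // f g = 0} := by
    rw [c, c, c, e0, ← Finset.sum_add_distrib, ← Finset.sum_add_distrib]
    refine Finset.sum_congr rfl fun g _ => ?_
    rcases hf g with h | h | h <;> simp [h, hs, hs.symm, hs2, hs2.symm]
  rw [e1] at h1
  rw [e2] at h2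
  have h1 := mul_left_cancel₀ hs h1
  have h2 := mul_left_cancel₀ (pow_ne_zero 2 hs) h2
  refine ⟨?_, ?_, ?_⟩ <;> linarith

/-! ### The radical as a K-space of dimension at most two. -/

section Radical

variable {F : Type*} [Field F] [Fintype F] [Algebra (ZMod 2) F] {n m : ℕ}
  (hn : n = 2 * m) (hF : Fintype.card F = 2 ^ n)

include hn hF

/-- On K the Frobenius powers with exponents m + k and 2m are both trivial, so exponents k, −k and m
agree. Consequently all three terms of `polarMap` scale by the same factor. -/
theorem pow_two_pow_of_mem {k : ℕ} {c : F} (hc : c ∈ subfieldPow F (m + k)) :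
    c ^ 2 ^ k = c ^ 2 ^ m := by
  apply pow_two_pow_injective m
  change (c ^ 2 ^ k) ^ 2 ^ m = (c ^ 2 ^ m) ^ 2 ^ m
  rw [pow_two_pow_half hn hF, ← pow_mul, ← pow_add, add_comm k m, mem_subfieldPow.1 hc]

theorem pow_two_pow_sub_of_mem {k : ℕ} (hk : k ≤ n) {c : F} (hc : c ∈ subfieldPow F (m + k)) :
    c ^ 2 ^ (n - k) = c ^ 2 ^ m := by
  apply pow_two_pow_injective m
  change (c ^ 2 ^ (n - k)) ^ 2 ^ m = (c ^ 2 ^ m) ^ 2 ^ m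
  rw [pow_two_pow_half hn hF, pow_right_comm, ← pow_two_pow_of_mem hn hF hc, ← pow_mul, ← pow_add,
    Nat.add_sub_cancel' hk, pow_two_pow_card hF]

theorem polarMap_mul {k : ℕ} (hk : k ≤ n) (α : subfieldPow F m) (β : F) {c : F}
    (hc : c ∈ subfieldPow F (m + k)) (y : F) :
    polarMap n k α β (c * y) = c ^ 2 ^ m * polarMap n k α β y := by
  rw [polarMap_apply, polarMap_apply, mul_left_comm β, mul_pow c y, mul_pow c y, mul_pow c (β * y),
    pow_two_pow_of_mem hn hF hc, pow_two_pow_sub_of_mem hn hF hk hc]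
  ring

/-- The radical as a subspace over the fixed field of `x ↦ x ^ (2 ^ (m + k))`. -/
def radicalSubspace {k : ℕ} (hk : k ≤ n) (α : subfieldPow F m) (β : F) :
    Submodule (subfieldPow F (m + k)) F where
  __ := radical n k α β
  smul_mem' c y hy := by
    change polarMap n k α β (c * y) = 0
    rw [polarMap_mul hn hF hk α β c.2, show polarMap n k α β y = 0 from hy, mul_zero]

theorem card_radical_eq_pow {k : ℕ} (hk : k ≤ n) (α : subfieldPow F m) (β : F) :
    ∃ r, Nat.card (radical n k α β) = Nat.card (subfieldPow F (m + k)) ^ r :=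
  ⟨_, Module.natCard_eq_pow_finrank (K := subfieldPow F (m + k))
    (V := radicalSubspace hn hF hk α β)⟩

omit hn hF in
theorem card_le_of_div_mem {ι : Type*} {K : IntermediateField (ZMod 2) F} {y : F} (hy : y ≠ 0)
    {f : ι → F} (hf : Function.Injective f) (hK : ∀ i, f i / y ∈ K) :
    Nat.card ι ≤ Nat.card K :=
  Nat.card_le_card_of_injective (fun i => (⟨f i / y, hK i⟩ : K)) fun i j h => by
    have := Subtype.ext_iff.1 h
    exact hf ((div_left_inj' hy).1 this)

/-- The 2^k-th power of φ(y) = 0 clears the exponent n − k. The result is a second order linear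
equation in σ. -/
theorem radical_equation {k : ℕ} (hk : k ≤ n) {α : subfieldPow F m} {β y : F}
    (hy : y ∈ radical n k α β) :
    β ^ 2 ^ k * (y ^ 2 ^ (m + k)) ^ 2 ^ (m + k) + (α : F) ^ 2 ^ k * y ^ 2 ^ (m + k) +
      β * y = 0 := by
  have h := congrArg (fun x => x ^ 2 ^ k) (mem_radical.1 hy)
  simp only [polarMap_apply, add_pow_two_pow, mul_pow] at h
  have e1 : (y ^ 2 ^ (m + k)) ^ 2 ^ (m + k) = (y ^ 2 ^ k) ^ 2 ^ k := by
    rw [pow_add, pow_mul, pow_mul, pow_right_comm (y ^ 2 ^ m), pow_two_pow_half hn hF]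
  have e2 : ∀ x : F, (x ^ 2 ^ (n - k)) ^ 2 ^ k = x := fun x => by
    rw [← pow_mul, ← pow_add, Nat.sub_add_cancel hk, pow_two_pow_card hF]
  rw [e2, e2, zero_pow (by positivity)] at h
  rw [e1, pow_add 2 m k, pow_mul]
  linear_combination h

/-- Reduction of order: for a fixed nonzero solution y, the map x ↦ σ(x/y) + x/y has kernel inside
Ky, and its image solves a first order equation. Each therefore has at most |K| elements. -/
theorem card_radical_le {k : ℕ} (hk : k ≤ n) {α : subfieldPow F m} {β : F}
    (h : (α, β) ≠ (0, 0)) :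
    Nat.card (radical n k α β) ≤ Nat.card (subfieldPow F (m + k)) ^ 2 := by
  have hpos : 1 ≤ Nat.card (subfieldPow F (m + k)) ^ 2 :=
    Nat.one_le_pow _ _ Nat.card_pos
  by_cases htriv : radical n k α β = ⊥
  · rw [htriv, AddSubgroup.card_bot]
    exact hpos
  obtain ⟨⟨y, hy⟩, hy0⟩ := AddSubgroup.ne_bot_iff_exists_ne_zero.1 htriv
  replace hy0 : y ≠ 0 := fun h => hy0 (Subtype.ext h)
  by_cases hβ : β = 0
  · exfalso
    have h1 := mem_radical.1 hy
    rw [polarMap_apply, hβ] at h1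
    have h2 : (α : F) ≠ 0 := fun h0 => h (Prod.ext (Subtype.ext h0) hβ)
    simp [h2, hy0] at h1
  let g : radical n k α β →+ F :=
    { toFun := fun x => (x / y : F) ^ 2 ^ (m + k) + x / y
      map_zero' := by simp
      map_add' := fun a b => by
        rw [AddSubgroup.coe_add, add_div, add_pow_two_pow]
        ring }
  have := charP_two F
  have hker : Nat.card g.ker ≤ Nat.card (subfieldPow F (m + k)) := by
    refine card_le_of_div_mem (f := fun x : g.ker => ((x : radical n k α β) : F)) hy0
      (Subtype.val_injective.comp Subtype.val_injective) fun x => ?_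
    rw [mem_subfieldPow]
    exact CharTwo.add_eq_zero.1 x.2
  -- With x = y t, subtracting σ(t) times the equation of y from that of x removes the α term and
  -- leaves a first order equation for g(x).
  have hrel : ∀ x, β ^ 2 ^ k * (y ^ 2 ^ (m + k)) ^ 2 ^ (m + k) * g x ^ 2 ^ (m + k) =
      β * y * g x := by
    intro x
    have h1 := radical_equation hn hF hk x.2
    have h2 := radical_equation hn hF hk hy
    obtain ⟨t, ht⟩ : ∃ t : F, (x : F) = y * t := ⟨x / y, by field_simp⟩
    have hg : g x = t ^ 2 ^ (m + k) + t := by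
      change (x / y : F) ^ 2 ^ (m + k) + x / y = _
      rw [ht, mul_div_cancel_left₀ _ hy0]
    rw [ht] at h1
    simp only [mul_pow] at h1
    rw [hg, add_pow_two_pow]
    have h3 : (2 : F) = 0 := CharTwo.two_eq_zero
    linear_combination h1 - t ^ 2 ^ (m + k) * h2 +
      (β ^ 2 ^ k * (y ^ 2 ^ (m + k)) ^ 2 ^ (m + k) * t ^ 2 ^ (m + k) - β * y * t) * h3
  have hrange : Nat.card g.range ≤ Nat.card (subfieldPow F (m + k)) := by
    by_cases h0 : ∃ s ∈ g.range, s ≠ 0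
    · obtain ⟨_, ⟨x0, rfl⟩, hs⟩ := h0
      refine card_le_of_div_mem hs (f := fun x : g.range => (x : F)) Subtype.val_injective ?_
      rintro ⟨_, x, rfl⟩
      have h1 := hrel x
      have h2 := hrel x0
      have h3 : β ^ 2 ^ k * (y ^ 2 ^ (m + k)) ^ 2 ^ (m + k) ≠ 0 := by simp [hβ, hy0]
      have h4 : β * y ≠ 0 := mul_ne_zero hβ hy0
      -- The quotient of two solutions of the first order equation is fixed by σ.
      rw [mem_subfieldPow, div_pow, ← mul_div_mul_left _ _ h3, h1, h2, mul_div_mul_left _ _ h4]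
    · push Not at h0
      have : g.range = ⊥ := (AddSubgroup.eq_bot_iff_forall _).2 h0
      rw [this, AddSubgroup.card_bot]
      exact Nat.card_pos
  have := g.ker.card_mul_index
  rw [AddSubgroup.index_ker] at this
  rw [← this, sq]
  exact Nat.mul_le_mul hker hrange

end Radical

/-! ### Arithmetic of d and d'. -/

section Exponents

theorem gcd_two_mul_add (m k : ℕ) : (2 * m).gcd (m + k) = (m + k).gcd (2 * k) := by
  apply Nat.dvd_antisymm
  · refine Nat.dvd_gcd (Nat.gcd_dvd_right _ _) ?_
    rw [← Nat.dvd_add_right (Nat.gcd_dvd_left (2 * m) (m + k)), ← mul_add]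
    exact (Nat.gcd_dvd_right _ _).mul_left 2
  · refine Nat.dvd_gcd ?_ (Nat.gcd_dvd_left _ _)
    rw [← Nat.dvd_add_left (Nat.gcd_dvd_right (m + k) (2 * k)), ← mul_add]
    exact (Nat.gcd_dvd_left _ _).mul_left 2

/-- With `d = gcd m k`, either `gcd (m + k) (2 k) = d`, or it is `2 d` and `m / d`, `k / d` are odd;
in both cases it is less than `m`. -/
theorem gcd_cases {m k : ℕ} (hk1 : 1 ≤ k) (hk2 : k < 2 * m) (hkm : k ≠ m) :
    ∃ d a b : ℕ, d = m.gcd k ∧ 0 < d ∧ m = d * a ∧ k = d * b ∧ 2 ≤ a ∧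
      ((m + k).gcd (2 * k) = d ∨
        (m + k).gcd (2 * k) = 2 * d ∧ Odd a ∧ Odd b ∧ 3 ≤ a) := by
  have hd : 0 < m.gcd k := Nat.gcd_pos_of_pos_right _ hk1
  obtain ⟨a, b, hab, ha, hb⟩ := Nat.exists_coprime m k
  have hm' : m = m.gcd k * a := by rw [mul_comm]; exact ha
  have hk' : k = m.gcd k * b := by rw [mul_comm]; exact hb
  -- If a = 1, then m divides k, and 1 ≤ k < 2m leaves only the excluded k = m.
  have ha2 : 2 ≤ a := by
    by_contra! hlt
    interval_cases a
    · omega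
    · rw [mul_one] at hm'
      rw [← hm'] at hk'
      have : b < 2 := by
        by_contra! hb2
        have := Nat.mul_le_mul_left m hb2
        omega
      interval_cases b <;> omega
  refine ⟨m.gcd k, a, b, rfl, hd, hm', hk', ha2, ?_⟩
  have e : (m + k).gcd (2 * k) = m.gcd k * (a + b).gcd (2 * b) := by
    rw [← Nat.gcd_mul_left, mul_add, ← hm', mul_left_comm, ← hk']
  have e2 : (a + b).gcd (2 * b) = (a + b).gcd 2 := by
    refine Nat.Coprime.gcd_mul_right_cancel_right 2 ?_
    exact (Nat.coprime_add_self_left.2 hab).symm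
  rw [e, e2]
  rcases Nat.even_or_odd (a + b) with h | h
  · right
    have hodd : Odd a ∧ Odd b := by
      rcases Nat.even_or_odd a with ha' | ha'
      · have hb' : Even b := (Nat.even_add.1 h).1 ha'
        have := Nat.dvd_gcd ha'.two_dvd hb'.two_dvd
        rw [hab] at this
        omega
      · exact ⟨ha', by
          rw [Nat.even_add, ← Nat.not_odd_iff_even, ← Nat.not_odd_iff_even] at h
          tauto⟩
    refine ⟨by rw [Nat.gcd_eq_right h.two_dvd, mul_comm], hodd.1, hodd.2, ?_⟩
    have := hodd.1
    rcases this with ⟨c, hc⟩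
    omega
  · left
    rw [Nat.Coprime.gcd_eq_one (Nat.coprime_two_right.2 h), mul_one]

end Exponents

/-! ### Parity of the K-dimension of the radical. -/

section Parity

variable {F : Type*} [Field F] [Fintype F] [Algebra (ZMod 2) F] {n m : ℕ}
  (hn : n = 2 * m) (hF : Fintype.card F = 2 ^ n)

/-- The polarization of `phase` as a bilinear form over the prime field. -/
def polarForm (n k : ℕ) (α : subfieldPow F m) (β : F) : LinearMap.BilinForm (ZMod 2) F :=
  (Algebra.traceForm (ZMod 2) F).compRight ((polarMap n k α β).toZModLinearMap 2)

theorem polarForm_apply (n k : ℕ) (α : subfieldPow F m) (β x y : F) :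
    polarForm n k α β x y = Algebra.trace (ZMod 2) F (x * polarMap n k α β y) := rfl

include hn hF

theorem polarForm_comm {k : ℕ} (hk : k ≤ n) (α : subfieldPow F m) (β x y : F) :
    polarForm n k α β x y = polarForm n k α β y x := by
  have h1 := phase_add hn hF hk α β 0 x y
  have h2 := phase_add hn hF hk α β 0 y x
  rw [add_comm y x, h1, add_comm (phase hn hF k α β 0 y)] at h2
  exact add_left_cancel h2

theorem polarForm_self {k : ℕ} (hk : k ≤ n) (α : subfieldPow F m) (β x : F) :
    polarForm n k α β x x = 0 := by
  have := charP_two F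
  have h1 := phase_add hn hF hk α β 0 x x
  rw [CharTwo.add_self_eq_zero, phase_zero, CharTwo.add_self_eq_zero, zero_add] at h1
  exact h1.symm

theorem polarForm_mul_right {k : ℕ} (hk : k ≤ n) (α : subfieldPow F m) (β : F) {c : F}
    (hc : c ∈ subfieldPow F (m + k)) (hcm : c ∈ subfieldPow F m) (x y : F) :
    polarForm n k α β x (c * y) = polarForm n k α β (c * x) y := by
  rw [polarForm_apply, polarForm_apply, polarMap_mul hn hF hk α β hc, mem_subfieldPow.1 hcm,
    mul_left_comm, mul_assoc]

/-- Moving c across the trace turns the form of (α, β) into that of (cα, cβ), which is alternating.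
-/
theorem polarForm_mul_self {k : ℕ} (hk : k ≤ n) (α : subfieldPow F m) (β : F) {c : F}
    (hc : c ∈ subfieldPow F (m + k)) (hcm : c ∈ subfieldPow F m) (x : F) :
    polarForm n k α β (c * x) x = 0 := by
  rw [← polarForm_self hn hF hk (⟨c, hcm⟩ * α) (c * β) x, polarForm_apply, polarForm_apply,
    mul_comm c x, mul_assoc]
  congr 2
  rw [polarMap_apply, polarMap_apply, mul_assoc c β x, mul_pow c (β * x),
    pow_two_pow_sub_of_mem hn hF hk hc, mem_subfieldPow.1 hcm]
  push_cast
  ring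

/-- When the fixed field `K` of `x ↦ x ^ (2 ^ (m + k))` lies in the subfield of order `2 ^ m`, a
maximal totally isotropic `K`-subspace shows that `|F| |radical|` is an even power of `|K|`. -/
theorem card_mul_card_radical {k : ℕ} (hk : k ≤ n)
    (hK : ∀ c ∈ subfieldPow F (m + k), c ∈ subfieldPow F m) (α : subfieldPow F m) (β : F) :
    ∃ r, Nat.card F * Nat.card (radical n k α β) = (Nat.card (subfieldPow F (m + k)) ^ r) ^ 2 := by
  set B := polarForm n k α β with hB
  let K := subfieldPow F (m + k)
  have hrefl : B.IsRefl := fun x y h => by rw [hB, polarForm_comm hn hF hk, ← hB, h]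
  obtain ⟨W, hW, hmax⟩ := (Set.toFinite
    {W : Submodule K F | ∀ x ∈ W, ∀ y ∈ W, B x y = 0}).exists_maximal ⟨⊥, by simp⟩
  set W₂ := W.restrictScalars (ZMod 2) with hW₂
  -- A vector y orthogonal to W can be adjoined: W + Ky stays isotropic because K acts by
  -- self-adjoint maps and B(cy, y) = 0. Maximality puts y in W.
  have horth : B.orthogonal W₂ = W₂ := by
    apply le_antisymm
    · intro y hy
      have hy' : ∀ w ∈ W, B w y = 0 := fun w hw => hy w hw
      have hle : W ≤ W ⊔ Submodule.span K {y} := le_sup_left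
      refine hmax ?_ hle (Submodule.mem_sup_right (Submodule.mem_span_singleton_self y))
      intro u hu v hv
      obtain ⟨w, hw, _, hu', rfl⟩ := Submodule.mem_sup.1 hu
      obtain ⟨w', hw', _, hv', rfl⟩ := Submodule.mem_sup.1 hv
      obtain ⟨c, rfl⟩ := Submodule.mem_span_singleton.1 hu'
      obtain ⟨c', rfl⟩ := Submodule.mem_span_singleton.1 hv'
      have e1 : B w (c' • y) = 0 := by
        rw [show c' • y = (c' : F) * y from rfl, hB,
          polarForm_mul_right hn hF hk α β c'.2 (hK c' c'.2)]
        exact hy' _ (W.smul_mem c' hw)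
      have e2 : B (c • y) w' = 0 := by
        rw [show c • y = (c : F) * y from rfl, hB,
          ← polarForm_mul_right hn hF hk α β c.2 (hK c c.2), polarForm_comm hn hF hk]
        exact hy' _ (W.smul_mem c hw')
      have e3 : B (c • y) (c' • y) = 0 := by
        rw [show c • y = (c : F) * y from rfl, show c' • y = (c' : F) * y from rfl, hB,
          polarForm_mul_right hn hF hk α β c'.2 (hK c' c'.2), ← mul_assoc]
        exact polarForm_mul_self hn hF hk α β (mul_mem c'.2 c.2)
          (mul_mem (hK c' c'.2) (hK c c.2)) y
      simp only [map_add, LinearMap.add_apply, e1, e2, e3, hW w hw w' hw', add_zero]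
    · intro y hy w hw
      exact hW w hw y hy
  have hrad : ∀ y, y ∈ B.orthogonal ⊤ ↔ y ∈ radical n k α β := by
    intro y
    rw [mem_radical]
    constructor
    · intro h
      by_contra hne
      obtain ⟨x, hx⟩ := exists_trace_mul_ne_zero hne
      refine hx ?_
      rw [mul_comm]
      exact h x trivial
    · intro h x _
      change B x y = 0
      rw [hB, polarForm_apply, h, mul_zero, map_zero]
  have hle : B.orthogonal ⊤ ≤ W₂ := by
    intro y hy
    rw [← horth]
    exact fun w _ => hy w trivial
  -- Since W is its own orthogonal and contains the radical, this reads 2 dim W = dim F + dim R over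
  -- F₂.
  have hfr := LinearMap.BilinForm.finrank_add_finrank_orthogonal hrefl W₂
  rw [horth, inf_eq_right.2 hle] at hfr
  have c1 := Module.natCard_eq_pow_finrank (K := ZMod 2) (V := F)
  have c2 := Module.natCard_eq_pow_finrank (K := ZMod 2) (V := W₂)
  have c3 := Module.natCard_eq_pow_finrank (K := ZMod 2) (V := B.orthogonal ⊤)
  have c4 := Module.natCard_eq_pow_finrank (K := K) (V := W)
  have c5 : Nat.card (B.orthogonal ⊤) = Nat.card (radical n k α β) :=
    Nat.card_congr (Equiv.subtypeEquivRight hrad)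
  have c6 : Nat.card W₂ = Nat.card W := rfl
  refine ⟨Module.finrank K W, ?_⟩
  rw [← c4, ← c6, ← c5, c1, c2, c3, ← pow_add, ← hfr, pow_add, sq]

end Parity

open Classical in
theorem natCard_subtype_eq_sum {X : Type*} [Fintype X] (p : X → Prop) :
    Nat.card {x // p x} = ∑ x, if p x then 1 else 0 := by
  rw [Nat.card_eq_fintype_card, Fintype.card_subtype, Finset.card_filter]

theorem sum_natCard_comm {X Y : Type*} [Fintype X] [Fintype Y] (r : X → Y → Prop) :
    ∑ x, Nat.card {y // r x y} = ∑ y, Nat.card {x // r x y} := by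
  simp_rw [natCard_subtype_eq_sum]
  exact Finset.sum_comm

/-! ### The mean size of the radical. -/

section Moment

variable {F : Type*} [Field F] [Fintype F] [Algebra (ZMod 2) F] {n m : ℕ}
  (hn : n = 2 * m) (hF : Fintype.card F = 2 ^ n)

/-- The elements of the subfield of order `2 ^ m` fixed by `x ↦ x ^ (2 ^ k)`. -/
def fixedSubgroup (F : Type*) [Field F] [Algebra (ZMod 2) F] (m k : ℕ) :
    AddSubgroup (subfieldPow F m) where
  carrier := {u | (u : F) ∈ subfieldPow F k}
  zero_mem' := zero_mem (subfieldPow F k)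
  add_mem' {a b} ha hb := by
    change (a : F) + b ∈ subfieldPow F k
    exact add_mem ha hb
  neg_mem' {a} ha := by
    change -(a : F) ∈ subfieldPow F k
    exact neg_mem ha

include hn hF

theorem card_fixedSubgroup (k : ℕ) : Nat.card (fixedSubgroup F m k) = 2 ^ m.gcd k := by
  have h : n.gcd (m.gcd k) = m.gcd k :=
    Nat.gcd_eq_right ((Nat.gcd_dvd_left m k).trans (hn ▸ Dvd.intro_left 2 rfl))
  rw [← h, ← card_subfieldPow hF]
  refine Nat.card_congr (Equiv.ofBijective (fun u => ⟨u, mem_subfieldPow_gcd u.1.2 u.2⟩) ⟨?_, ?_⟩)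
  · intro u v huv
    exact Subtype.ext (Subtype.ext (congrArg Subtype.val huv :))
  · rintro ⟨x, hx⟩
    exact ⟨⟨⟨x, subfieldPow_mono (Nat.gcd_dvd_left m k) hx⟩,
      subfieldPow_mono (Nat.gcd_dvd_right m k) hx⟩, rfl⟩

/-- Put w = β y^(2^k+1). Then y lies in the radical exactly when α y^(2^m+1) = w + w^(2^(n−k)), so w
determines the pair. The only condition is that the right side lie in the field of order 2^m. -/
theorem card_pairs_of_mem_radical {k : ℕ} (hk : k ≤ n) {y : F} (hy : y ≠ 0) :
    Nat.card {p : subfieldPow F m × F // y ∈ radical n k p.1 p.2} = 2 ^ (m + m.gcd k) := by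
  have := charP_two F
  have e2 : ∀ x : F, (x ^ 2 ^ (n - k)) ^ 2 ^ k = x := fun x => by
    rw [← pow_mul, ← pow_add, Nat.sub_add_cancel hk, pow_two_pow_card hF]
  have hyN : y ^ (2 ^ m + 1) ≠ 0 := pow_ne_zero _ hy
  have hyk : y ^ (2 ^ k + 1) ≠ 0 := pow_ne_zero _ hy
  have key : ∀ (α : subfieldPow F m) (β : F), y ∈ radical n k α β ↔
      (α : F) * y ^ (2 ^ m + 1) =
        β * y ^ (2 ^ k + 1) + (β * y ^ (2 ^ k + 1)) ^ 2 ^ (n - k) := by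
    intro α β
    have h1 : y * polarMap n k α β y = α * y ^ (2 ^ m + 1) +
        (β * y ^ (2 ^ k + 1) + (β * y ^ (2 ^ k + 1)) ^ 2 ^ (n - k)) := by
      have h2 : (y ^ 2 ^ k) ^ 2 ^ (n - k) = y := by rw [pow_right_comm, e2]
      rw [polarMap_apply, pow_succ y (2 ^ k), mul_left_comm β, mul_pow (y ^ 2 ^ k), h2]
      ring
    rw [mem_radical, ← CharTwo.add_eq_zero (a := (α : F) * _), ← h1, mul_eq_zero, or_iff_right hy]
  -- After a 2^k-th power both conditions involve the same four conjugates of w, and in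
  -- characteristic 2 they coincide. The admissible w thus form a preimage under the relative trace,
  -- which is easy to count.
  have mem : ∀ w : F, w ∈ (fixedSubgroup F m k).comap (relTrace hn hF) ↔
      w + w ^ 2 ^ (n - k) ∈ subfieldPow F m := by
    intro w
    change (w + w ^ 2 ^ m) ^ 2 ^ k = w + w ^ 2 ^ m ↔
      (w + w ^ 2 ^ (n - k)) ^ 2 ^ m = w + w ^ 2 ^ (n - k)
    rw [← (pow_two_pow_injective (F := F) k).eq_iff
      (a := (w + w ^ 2 ^ (n - k)) ^ 2 ^ m) (b := w + w ^ 2 ^ (n - k))]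
    simp only [add_pow_two_pow, e2]
    rw [pow_right_comm (w ^ 2 ^ (n - k)) (2 ^ m) (2 ^ k), e2]
    have h2 : (2 : F) = 0 := CharTwo.two_eq_zero
    constructor <;> intro h
    · linear_combination h + (w ^ 2 ^ m - w ^ 2 ^ k) * h2
    · linear_combination h + (w ^ 2 ^ k - w ^ 2 ^ m) * h2
  rw [pow_add, ← card_fixedSubgroup hn hF, ← card_preimage_relTrace hn hF]
  refine Nat.card_congr (Equiv.ofBijective
    (fun p => ⟨p.1.2 * y ^ (2 ^ k + 1), (mem _).2 ?_⟩) ⟨?_, ?_⟩)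
  · rw [← (key _ _).1 p.2]
    exact mul_mem p.1.1.2 (powElt hn hF y).2
  · rintro ⟨⟨α, β⟩, h⟩ ⟨⟨α', β'⟩, h'⟩ heq
    have h1 : β * y ^ (2 ^ k + 1) = β' * y ^ (2 ^ k + 1) := Subtype.ext_iff.1 heq
    have hβ : β = β' := mul_right_cancel₀ hyk h1
    have h2 := (key _ _).1 h
    have h3 := (key _ _).1 h'
    simp only at h2 h3
    rw [hβ, ← h3] at h2
    have hα : α = α' := Subtype.ext (mul_right_cancel₀ hyN h2)
    simp [hα, hβ]
  · rintro ⟨w, hw⟩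
    have hw := (mem _).1 hw
    refine ⟨⟨⟨⟨(w + w ^ 2 ^ (n - k)) / y ^ (2 ^ m + 1), div_mem hw (powElt hn hF y).2⟩,
      w / y ^ (2 ^ k + 1)⟩, (key _ _).2 ?_⟩, ?_⟩
    · simp only [div_mul_cancel₀ _ hyN, div_mul_cancel₀ _ hyk]
    · exact Subtype.ext (div_mul_cancel₀ _ hyk)

theorem sum_card_radical [Fintype (subfieldPow F m)] {k : ℕ} (hk : k ≤ n) :
    ∑ p : subfieldPow F m × F, Nat.card (radical n k p.1 p.2) =
      2 ^ (3 * m) + (2 ^ n - 1) * 2 ^ (m + m.gcd k) := by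
  classical
  have h3 : ∀ y : F, Nat.card {p : subfieldPow F m × F // y ∈ radical n k p.1 p.2} =
      if y = 0 then 2 ^ (3 * m) else 2 ^ (m + m.gcd k) := fun y => by
    split_ifs with hy
    · have h0 : ∀ p : subfieldPow F m × F, y ∈ radical n k p.1 p.2 := fun p =>
        hy ▸ (radical n k p.1 p.2).zero_mem
      rw [Nat.card_congr (Equiv.subtypeUnivEquiv h0), Nat.card_prod, card_subfieldPow_half hn hF,
        card_eq_sq hn hF]
      ring
    · exact card_pairs_of_mem_radical hn hF hk hy
  refine (sum_natCard_comm fun (p : subfieldPow F m × F) y => y ∈ radical n k p.1 p.2).trans ?_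
  rw [Finset.sum_congr rfl fun y _ => h3 y, ← Finset.add_sum_erase _ _ (Finset.mem_univ 0),
    if_pos rfl, Finset.sum_congr rfl fun y hy => if_neg (Finset.ne_of_mem_erase hy),
    Finset.sum_const, Finset.card_erase_of_mem (Finset.mem_univ _), Finset.card_univ, hF, smul_eq_mul]

end Moment

/-! ### Words given by linear functionals, and the size of a cyclic code. -/

section Functional

variable {L : Type*} [Field L] [Algebra (ZMod 2) L]

/-- Apply a linear functional to the coefficients of a polynomial. -/
def coeffMap (f : L →ₗ[ZMod 2] ZMod 2) (p : L[X]) : (ZMod 2)[X] :=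
  p.sum fun i c => monomial i (f c)

theorem coeff_coeffMap (f : L →ₗ[ZMod 2] ZMod 2) (p : L[X]) (i : ℕ) :
    (coeffMap f p).coeff i = f (p.coeff i) := by
  rw [coeffMap, sum_def, finsetSum_coeff]
  simp only [coeff_monomial]
  rw [Finset.sum_ite_eq' p.support i fun j => f (p.coeff j)]
  split_ifs with h
  · rfl
  · rw [notMem_support_iff.1 h, map_zero]

theorem coeffMap_map_mul (f : L →ₗ[ZMod 2] ZMod 2) (h : (ZMod 2)[X]) (p : L[X]) :
    coeffMap f (h.map (algebraMap (ZMod 2) L) * p) = h * coeffMap f p := by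
  ext i
  rw [coeff_coeffMap, coeff_mul, coeff_mul, map_sum]
  refine Finset.sum_congr rfl fun j _ => ?_
  rw [coeff_map, coeff_coeffMap, ← Algebra.smul_def, map_smul, smul_eq_mul]

theorem coeff_wordPoly {l : ℕ} (c : Fin l → ZMod 2) (i : ℕ) :
    (wordPoly c).coeff i = if h : i < l then c ⟨i, h⟩ else 0 := by
  simp only [wordPoly, finsetSum_coeff, coeff_C_mul_X_pow]
  split_ifs with h
  · rw [Finset.sum_eq_single ⟨i, h⟩]
    · simp
    · intro j _ hj
      exact if_neg fun hij => hj (Fin.ext hij.symm)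
    · simp
  · refine Finset.sum_eq_zero fun j _ => if_neg fun hij => h (by omega)

/-- The word with entries `f (a ^ i)` belongs to the cyclic code whose parity-check polynomial
vanishes at `a⁻¹`. -/
theorem functional_word_mem {l : ℕ} (f : L →ₗ[ZMod 2] ZMod 2) {a : L} (ha0 : a ≠ 0)
    (ha : a ^ l = 1) {h : (ZMod 2)[X]} (hh : aeval a⁻¹ h = 0) :
    (fun i : Fin l => f (a ^ (i : ℕ))) ∈ cyclicCode l h := by
  change (X ^ l - 1 : (ZMod 2)[X]) ∣ h * wordPoly _
  set P : L[X] := ∑ i ∈ Finset.range l, (C a * X) ^ i with hP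
  have h1 : wordPoly (fun i : Fin l => f (a ^ (i : ℕ))) = coeffMap f P := by
    ext i
    rw [coeff_wordPoly, coeff_coeffMap, hP, finsetSum_coeff]
    simp only [mul_pow, ← C_pow, coeff_C_mul_X_pow]
    rw [Finset.sum_ite_eq]
    simp only [Finset.mem_range]
    split_ifs <;> simp
  obtain ⟨h', hh'⟩ : X - C a⁻¹ ∣ h.map (algebraMap (ZMod 2) L) := by
    rw [dvd_iff_isRoot, IsRoot.def, eval_map_algebraMap, hh]
  -- Over L, (aX − 1) P = X^l − 1 because a^l = 1, and aX − 1 divides h up to a unit. The functional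
  -- is then applied to coefficients, which commutes with multiplication by binary polynomials.
  have h2 : h.map (algebraMap (ZMod 2) L) * P =
      (X ^ l - 1 : (ZMod 2)[X]).map (algebraMap (ZMod 2) L) * (C a⁻¹ * h') := by
    have h3 := geom_sum_mul (C a * X) l
    rw [← hP, mul_pow, ← C_pow, ha, C_1, one_mul] at h3
    have h4 : (X - C a⁻¹ : L[X]) = C a⁻¹ * (C a * X - 1) := by
      rw [mul_sub, ← mul_assoc, ← C_mul, inv_mul_cancel₀ ha0, C_1, one_mul, mul_one]
    rw [Polynomial.map_sub, Polynomial.map_pow, map_X, Polynomial.map_one, ← h3, hh', h4]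
    ring
  rw [h1, ← coeffMap_map_mul, h2, coeffMap_map_mul]
  exact dvd_mul_right _ _

theorem cyclicCode_mono {l : ℕ} {h h' : (ZMod 2)[X]} (hd : h ∣ h') :
    cyclicCode l h ≤ cyclicCode l h' :=
  fun _ hc => dvd_trans hc (mul_dvd_mul_right hd _)

/-- A codeword c is determined by the quotient h c / (X^l − 1), whose degree is below deg h. -/
theorem card_cyclicCode_le {l : ℕ} (hl : 0 < l) {h : (ZMod 2)[X]} (hh : h ≠ 0) :
    Nat.card (cyclicCode l h) ≤ 2 ^ h.natDegree := by
  have hdvd : ∀ c : cyclicCode l h, ∃ p : (ZMod 2)[X],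
      h * wordPoly (c : Fin l → ZMod 2) = (X ^ l - 1) * p := fun c => c.2
  choose p hp using hdvd
  have hX : (X ^ l - 1 : (ZMod 2)[X]) ≠ 0 := X_pow_sub_C_ne_zero hl 1
  have hdeg : ∀ c, ∀ i, h.natDegree ≤ i → (p c).coeff i = 0 := by
    intro c i hi
    by_cases h0 : p c = 0
    · rw [h0, coeff_zero]
    refine coeff_eq_zero_of_natDegree_lt (lt_of_lt_of_le ?_ hi)
    have hw : wordPoly (c : Fin l → ZMod 2) ≠ 0 := fun hw => by
      have := hp c
      rw [hw, mul_zero, eq_comm, mul_eq_zero, or_iff_right hX] at this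
      exact h0 this
    have h1 := congrArg natDegree (hp c)
    rw [natDegree_mul hh hw, natDegree_mul hX h0,
      show (X ^ l - 1 : (ZMod 2)[X]).natDegree = l from natDegree_X_pow_sub_C (r := 1)] at h1
    have h2 : (wordPoly (c : Fin l → ZMod 2)).natDegree < l := by
      rw [natDegree_lt_iff_degree_lt hw, degree_lt_iff_coeff_zero]
      intro j hj
      rw [coeff_wordPoly, dif_neg (not_lt.2 hj)]
    omega
  have hinj : Function.Injective fun (c : cyclicCode l h) (i : Fin h.natDegree) =>
      (p c).coeff i := by
    intro c c' hcc
    have h1 : p c = p c' := by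
      ext i
      by_cases hi : i < h.natDegree
      · exact congrFun hcc ⟨i, hi⟩
      · rw [hdeg c i (not_lt.1 hi), hdeg c' i (not_lt.1 hi)]
    have h2 := hp c
    rw [h1, ← hp c'] at h2
    have h3 := mul_left_cancel₀ hh h2
    apply Subtype.ext
    funext i
    have h4 := congrArg (fun q => coeff q (i : ℕ)) h3
    simpa only [coeff_wordPoly, i.2, dif_pos] using h4
  refine (Nat.card_le_card_of_injective _ hinj).trans_eq ?_
  simp

end Functional

/-! ### The words c(α, β, γ) fill the code, and their weights. -/

section Code

variable {F : Type*} [Field F] [Fintype F] [Algebra (ZMod 2) F] {n m : ℕ}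
  (hn : n = 2 * m) (hF : Fintype.card F = 2 ^ n)

theorem powElt_pow (x : F) (i : ℕ) : powElt hn hF (x ^ i) = powElt hn hF x ^ i :=
  Subtype.ext (pow_right_comm x i (2 ^ m + 1))

theorem word_mem_codeC2 (k : ℕ) {π : F} (hπ0 : π ≠ 0) (hπ : π ^ (2 ^ n - 1) = 1)
    (α : subfieldPow F m) (β γ : F) : word hn hF k π α β γ ∈ codeC2 n m k π := by
  have hE0 : powElt hn hF π ≠ 0 := fun h => pow_ne_zero (2 ^ m + 1) hπ0 (congrArg Subtype.val h)
  have hE1 : powElt hn hF π ^ (2 ^ n - 1) = 1 := by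
    rw [← powElt_pow, hπ]
    exact Subtype.ext (one_pow _)
  -- The third root is viewed inside the field of order 2^m, so that the trace of that field can
  -- serve as the functional.
  have m3 : aeval (powElt hn hF π)⁻¹ (minpoly (ZMod 2) (π ^ (2 ^ m + 1))⁻¹) = 0 := by
    apply (algebraMap (subfieldPow F m) F).injective
    rw [map_zero, ← aeval_algebraMap_apply, map_inv₀]
    exact minpoly.aeval _ _
  have e1 := functional_word_mem
    ((Algebra.trace (ZMod 2) F).comp (LinearMap.mulLeft (ZMod 2) γ)) hπ0 hπ
    (minpoly.aeval (ZMod 2) π⁻¹)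
  have e2 := functional_word_mem
    ((Algebra.trace (ZMod 2) F).comp (LinearMap.mulLeft (ZMod 2) β)) (pow_ne_zero (2 ^ k + 1) hπ0)
    (by rw [pow_right_comm, hπ, one_pow]) (minpoly.aeval (ZMod 2) (π ^ (2 ^ k + 1))⁻¹)
  have e3 := functional_word_mem ((Algebra.trace (ZMod 2) (subfieldPow F m)).comp
    (LinearMap.mulLeft (ZMod 2) α)) hE0 hE1 m3
  have h1 : _ ∈ codeC2 n m k π := cyclicCode_mono ((dvd_mul_right _ _).mul_right _) e1
  have h2 : _ ∈ codeC2 n m k π := cyclicCode_mono ((dvd_mul_left _ _).mul_right _) e2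
  have h3 : _ ∈ codeC2 n m k π := cyclicCode_mono (dvd_mul_left _ _) e3
  have key : ∀ {w f₁ f₂ f₃ : Fin (2 ^ n - 1) → ZMod 2}, f₁ ∈ codeC2 n m k π →
      f₂ ∈ codeC2 n m k π → f₃ ∈ codeC2 n m k π → (∀ i, w i = f₃ i + (f₂ i + f₁ i)) →
      w ∈ codeC2 n m k π := fun g₁ g₂ g₃ h => by
    rw [funext h]
    exact add_mem g₃ (add_mem g₂ g₁)
  refine key h1 h2 h3 fun i => ?_
  simp only [word, phase, map_add, powElt_pow, LinearMap.comp_apply, LinearMap.mulLeft_apply]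
  rw [pow_right_comm π]

include hn hF in
theorem card_codeC2_le (hm : 0 < m) (k : ℕ) (π : F) :
    Nat.card (codeC2 n m k π) ≤ Nat.card (subfieldPow F m × F × F) := by
  have hl : 0 < 2 ^ n - 1 := by
    have : 2 ^ 1 ≤ 2 ^ n := Nat.pow_le_pow_right (by norm_num) (by omega)
    omega
  have hne : ∀ x : F, minpoly (ZMod 2) x ≠ 0 := fun x =>
    minpoly.ne_zero (Algebra.IsIntegral.isIntegral x)
  refine (card_cyclicCode_le hl (mul_ne_zero (mul_ne_zero (hne _) (hne _)) (hne _))).trans ?_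
  rw [Nat.card_prod, Nat.card_prod, card_eq_sq hn hF, card_subfieldPow_half hn hF, ← pow_add,
    ← pow_add, ← pow_add]
  refine Nat.pow_le_pow_right (by norm_num) ?_
  rw [natDegree_mul (mul_ne_zero (hne _) (hne _)) (hne _), natDegree_mul (hne _) (hne _)]
  have h1 := minpoly.natDegree_le (A := ZMod 2) π⁻¹
  have h2 := minpoly.natDegree_le (A := ZMod 2) (π ^ (2 ^ k + 1))⁻¹
  have h3 := minpoly.natDegree_le (A := ZMod 2) (powElt hn hF π)⁻¹
  -- This root lies in the field of order 2^m, so its degree is at most m instead of 2m.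
  have h4 : minpoly (ZMod 2) (π ^ (2 ^ m + 1))⁻¹ = minpoly (ZMod 2) (powElt hn hF π)⁻¹ := by
    rw [← minpoly.algebraMap_eq (algebraMap (subfieldPow F m) F).injective, map_inv₀]
    rfl
  rw [finrank_eq hn hF] at h1 h2
  rw [finrank_subfieldPow_half hn hF] at h3
  rw [h4]
  omega

/-- A vanishing phase has radical F, too large for a nonzero pair (α, β); nondegeneracy of the trace
then gives γ = 0. -/
theorem phase_eq_zero_imp {k : ℕ} (hk : k ≤ n)
    (hlt : Nat.card (subfieldPow F (m + k)) ^ 2 < Nat.card F) {α : subfieldPow F m} {β γ : F}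
    (h : ∀ x, phase hn hF k α β γ x = 0) : α = 0 ∧ β = 0 ∧ γ = 0 := by
  have hrad : radical n k α β = ⊤ := by
    rw [eq_top_iff]
    intro y _
    by_contra hne
    obtain ⟨x, hx⟩ := exists_trace_mul_ne_zero hne
    have := phase_add hn hF hk α β γ x y
    rw [h, h, h, zero_add, zero_add, mul_comm] at this
    exact hx this.symm
  by_cases h0 : (α, β) = (0, 0)
  · obtain ⟨rfl, rfl⟩ := Prod.ext_iff.1 h0
    refine ⟨rfl, rfl, ?_⟩
    by_contra hγ
    obtain ⟨x, hx⟩ := exists_trace_mul_ne_zero hγ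
    refine hx ?_
    have := h x
    simpa [phase] using this
  · have := card_radical_le hn hF hk h0
    rw [hrad, AddSubgroup.card_top] at this
    omega

omit [Algebra (ZMod 2) F] in
include hF in
theorem exists_pow_eq {π : F} (hπ : IsPrimitiveRoot π (2 ^ n - 1)) (hn0 : 0 < n) {x : F}
    (hx : x ≠ 0) : ∃ i < 2 ^ n - 1, π ^ i = x := by
  have : NeZero (2 ^ n - 1) := ⟨by
    have : 2 ^ 1 ≤ 2 ^ n := Nat.pow_le_pow_right (by norm_num) (by omega)
    omega⟩
  refine hπ.eq_pow_of_pow_eq_one ?_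
  rw [← hF, FiniteField.pow_card_sub_one_eq_one x hx]

theorem word_injective {k : ℕ} (hk : k ≤ n) (hn0 : 0 < n)
    (hlt : Nat.card (subfieldPow F (m + k)) ^ 2 < Nat.card F) {π : F}
    (hπ : IsPrimitiveRoot π (2 ^ n - 1)) :
    Function.Injective fun p : subfieldPow F m × F × F => word hn hF k π p.1 p.2.1 p.2.2 := by
  have := charP_two F
  rintro ⟨α, β, γ⟩ ⟨α', β', γ'⟩ h
  have h1 : ∀ x, phase hn hF k (α + α') (β + β') (γ + γ') x = 0 := by
    intro x
    by_cases hx : x = 0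
    · rw [hx, phase_zero]
    · obtain ⟨i, hi, rfl⟩ := exists_pow_eq hF hπ hn0 hx
      rw [phase_triple_add]
      have := congrFun h ⟨i, hi⟩
      exact CharTwo.add_eq_zero.2 this
  obtain ⟨ha, hb, hc⟩ := phase_eq_zero_imp hn hF hk hlt h1
  have ha' : α = α' := Subtype.ext (CharTwo.add_eq_zero.1 (congrArg Subtype.val ha))
  rw [ha', CharTwo.add_eq_zero.1 hb, CharTwo.add_eq_zero.1 hc]

/-- Inclusion plus the bound on the size of the code suffices; the exact degrees and the coprimality
of the three minimal polynomials are not needed. -/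
theorem range_word {k : ℕ} (hk : k ≤ n) (hm : 0 < m)
    (hlt : Nat.card (subfieldPow F (m + k)) ^ 2 < Nat.card F) {π : F}
    (hπ : IsPrimitiveRoot π (2 ^ n - 1)) :
    Set.range (fun p : subfieldPow F m × F × F => word hn hF k π p.1 p.2.1 p.2.2) =
      (codeC2 n m k π : Set (Fin (2 ^ n - 1) → ZMod 2)) := by
  have hn0 : 0 < n := by omega
  have hπ0 : π ≠ 0 := by
    rintro rfl
    have h1 := hπ.pow_eq_one
    have : 2 ^ 1 ≤ 2 ^ n := Nat.pow_le_pow_right (by norm_num) hn0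
    rw [zero_pow (by omega)] at h1
    exact zero_ne_one h1
  refine Set.eq_of_subset_of_ncard_le ?_ ?_ (Set.toFinite _)
  · rintro _ ⟨p, rfl⟩
    exact word_mem_codeC2 hn hF k hπ0 hπ.pow_eq_one p.1 p.2.1 p.2.2
  · rw [← Set.image_univ,
      Set.ncard_image_of_injective _ (word_injective hn hF hk hn0 hlt hπ), Set.ncard_univ]
    exact card_codeC2_le hn hF hm k π

omit [Algebra (ZMod 2) F] in
include hF in
theorem sum_eq_add_sum_pow {π : F} (hπ : IsPrimitiveRoot π (2 ^ n - 1)) (hn0 : 0 < n)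
    (f : F → ℤ) : ∑ x, f x = f 0 + ∑ i ∈ Finset.range (2 ^ n - 1), f (π ^ i) := by
  classical
  have hπ0 : π ≠ 0 := by
    rintro rfl
    have h1 := hπ.pow_eq_one
    have : 2 ^ 1 ≤ 2 ^ n := Nat.pow_le_pow_right (by norm_num) hn0
    rw [zero_pow (by omega)] at h1
    exact zero_ne_one h1
  rw [← Finset.add_sum_erase _ _ (Finset.mem_univ 0)]
  congr 1
  symm
  refine Finset.sum_nbij (fun i => π ^ i) ?_ ?_ ?_ fun _ _ => rfl
  · intro i _
    exact Finset.mem_erase.2 ⟨pow_ne_zero i hπ0, Finset.mem_univ _⟩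
  · intro i hi j hj hij
    exact hπ.pow_inj (Finset.mem_range.1 hi) (Finset.mem_range.1 hj) hij
  · intro x hx
    obtain ⟨i, hi, rfl⟩ := exists_pow_eq hF hπ hn0 (Finset.mem_erase.1 hx).1
    exact ⟨i, Finset.mem_coe.2 (Finset.mem_range.2 hi), rfl⟩

/-- The word omits x = 0, whose term is 1; this turns 2^n − 1 into 2^n. -/
theorem expSum_eq_sub_hammingNorm {π : F} (hπ : IsPrimitiveRoot π (2 ^ n - 1)) (hn0 : 0 < n)
    (k : ℕ) (α : subfieldPow F m) (β γ : F) :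
    expSum hn hF k α β γ = 2 ^ n - 2 * hammingNorm (word hn hF k π α β γ) := by
  rw [expSum_eq, sum_eq_add_sum_pow hF hπ hn0, phase_zero, sgn_zero,
    ← Fin.sum_univ_eq_sum_range (fun i => sgn (phase hn hF k α β γ (π ^ i))), hammingNorm,
    Finset.card_filter]
  have h : ∀ v : ZMod 2, sgn v = 1 - 2 * (if v ≠ 0 then 1 else 0 : ℕ) := by decide
  simp only [h]
  rw [Finset.sum_sub_distrib, ← Finset.mul_sum]
  push_cast
  have : 1 ≤ 2 ^ n := Nat.one_le_two_pow
  simp only [Finset.sum_const, Finset.card_univ, Fintype.card_fin, nsmul_eq_mul, mul_one,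
    Nat.cast_sub this]
  push_cast
  unfold word
  ring

end Code

/-! ### The residue of S(α, β, 0) modulo 2^d + 1, and the sum of these values. -/

section Congruence

theorem sum_range_mul_of_periodic {P : ℕ} (f : ℕ → ℤ) (hf : ∀ i, f (i + P) = f i) (M : ℕ) :
    ∑ i ∈ Finset.range (M * P), f i = M * ∑ i ∈ Finset.range P, f i := by
  induction M with
  | zero => simp
  | succ M ih =>
    have h : ∀ j i, f (j * P + i) = f i := by
      intro j i
      induction j with
      | zero => simp
      | succ j ihj => rw [← ihj, ← hf (j * P + i)]; congr 1; ring
    rw [Nat.succ_mul, Finset.sum_range_add, ih]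
    simp_rw [h]
    push_cast
    ring

variable {F : Type*} [Field F] [Fintype F] [Algebra (ZMod 2) F] {n m : ℕ}
  (hn : n = 2 * m) (hF : Fintype.card F = 2 ^ n)

theorem two_pow_add_one_dvd (d : ℕ) {a : ℕ} (ha : Odd a) : 2 ^ d + 1 ∣ 2 ^ (d * a) + 1 := by
  have := ha.nat_add_dvd_pow_add_pow (2 ^ d) 1
  rwa [one_pow, ← pow_mul] at this

/-- If `m / d` and `k / d` are odd, multiplication by an element of order `2 ^ d + 1` preserves the
quadratic form. -/
theorem expSum_zero_modEq {π : F} (hπ : IsPrimitiveRoot π (2 ^ n - 1)) (hn0 : 0 < n) {k d a b : ℕ}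
    (hm : m = d * a) (hk : k = d * b) (ha : Odd a) (hb : Odd b) (α : subfieldPow F m) (β : F) :
    ((2 ^ d + 1 : ℕ) : ℤ) ∣ expSum hn hF k α β 0 - 1 := by
  have h1 : 2 ^ d + 1 ∣ 2 ^ n - 1 := by
    have h2 : 2 ^ n - 1 = (2 ^ m + 1) * (2 ^ m - 1) := by
      rw [hn, mul_comm 2 m, pow_mul, ← Nat.sq_sub_sq, one_pow]
    rw [h2, hm]
    exact (two_pow_add_one_dvd d ha).mul_right _
  obtain ⟨P, hP⟩ := h1
  -- The order of π^P divides 2^d + 1, which divides 2^e + 1 whenever e is an odd multiple of d.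
  have hpow : ∀ {c e : ℕ}, Odd c → e = d * c → (π ^ P) ^ (2 ^ e + 1) = 1 := by
    intro c e hc he
    obtain ⟨t, ht⟩ := two_pow_add_one_dvd d hc
    rw [he, ht, ← pow_mul, ← mul_assoc, mul_comm P, ← hP, pow_mul, hπ.pow_eq_one, one_pow]
  have hper : ∀ i, sgn (phase hn hF k α β 0 (π ^ (i + P))) =
      sgn (phase hn hF k α β 0 (π ^ i)) := by
    intro i
    have e1 : powElt hn hF (π ^ (i + P)) = powElt hn hF (π ^ i) := by
      apply Subtype.ext
      change (π ^ (i + P)) ^ (2 ^ m + 1) = (π ^ i) ^ (2 ^ m + 1)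
      rw [pow_add π, mul_pow, hpow ha hm, mul_one]
    have e2 : (π ^ (i + P)) ^ (2 ^ k + 1) = (π ^ i) ^ (2 ^ k + 1) := by
      rw [pow_add π, mul_pow, hpow hb hk, mul_one]
    simp only [phase, e1, e2, zero_mul]
  rw [expSum_eq, sum_eq_add_sum_pow hF hπ hn0, phase_zero, sgn_zero, add_sub_cancel_left, hP,
    sum_range_mul_of_periodic _ hper]
  exact dvd_mul_right _ _

/-- For x ≠ 0 the sum over β already vanishes, so only x = 0 contributes. -/
theorem sum_expSum_zero [Fintype (subfieldPow F m)] (k : ℕ) :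
    ∑ p : subfieldPow F m × F, expSum hn hF k p.1 p.2 0 = 2 ^ (3 * m) := by
  classical
  simp_rw [expSum_eq]
  rw [Finset.sum_comm]
  have h : ∀ x : F, ∑ p : subfieldPow F m × F, sgn (phase hn hF k p.1 p.2 0 x) =
      if x = 0 then 2 ^ (3 * m) else 0 := by
    intro x
    split_ifs with hx
    · simp only [hx, phase_zero, sgn_zero, Finset.sum_const, Finset.card_univ, Fintype.card_prod,
        nsmul_eq_mul, mul_one]
      rw [← Nat.card_eq_fintype_card, card_subfieldPow_half hn hF, hF, hn]
      push_cast
      ring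
    · have h1 : ∀ p : subfieldPow F m × F, sgn (phase hn hF k p.1 p.2 0 x) =
          sgn (Algebra.trace (ZMod 2) (subfieldPow F m) (p.1 * powElt hn hF x)) *
            sgn (Algebra.trace (ZMod 2) F (x ^ (2 ^ k + 1) * p.2)) := fun p => by
        rw [← sgn_add, phase, zero_mul, add_zero, mul_comm p.2]
      have h2 : x ^ (2 ^ k + 1) ≠ 0 := pow_ne_zero _ hx
      rw [Finset.sum_congr rfl fun p _ => h1 p, Fintype.sum_prod_type]
      simp_rw [← Finset.mul_sum, sum_sgn_trace_mul, if_neg h2, mul_zero, Finset.sum_const_zero]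
  rw [Finset.sum_congr rfl fun x _ => h x]
  simp

end Congruence

/-! ### From the sizes of the radicals to the multiplicities of the values. -/

section Counting

variable {F : Type*} [Field F] [Fintype F] [Algebra (ZMod 2) F] {n m : ℕ}
  (hn : n = 2 * m) (hF : Fintype.card F = 2 ^ n)

theorem expSum_cases {k j : ℕ} (hk : k ≤ n) {α : subfieldPow F m} {β : F}
    (hj : Nat.card (radical n k α β) = 2 ^ (2 * j)) (γ : F) :
    expSum hn hF k α β γ = 2 ^ (m + j) ∨ expSum hn hF k α β γ = -2 ^ (m + j) ∨
      expSum hn hF k α β γ = 0 := by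
  rcases expSum_sq hn hF hk α β γ with h | h
  · have h1 : expSum hn hF k α β γ ^ 2 = (2 ^ (m + j)) ^ 2 := by
      rw [h, hj, hn]
      push_cast
      ring
    rcases sq_eq_sq_iff_eq_or_eq_neg.1 h1 with h2 | h2
    · exact Or.inl h2
    · exact Or.inr (Or.inl h2)
  · exact Or.inr (Or.inr h)

theorem card_expSum_values {k j : ℕ} (hk : k ≤ n) (hjm : j ≤ m) {α : subfieldPow F m} {β : F}
    (hj : Nat.card (radical n k α β) = 2 ^ (2 * j)) :
    2 * (Nat.card {γ // expSum hn hF k α β γ = 2 ^ (m + j)} : ℤ) =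
        2 ^ (2 * (m - j)) + 2 ^ (m - j) ∧
      2 * (Nat.card {γ // expSum hn hF k α β γ = -2 ^ (m + j)} : ℤ) =
        2 ^ (2 * (m - j)) - 2 ^ (m - j) ∧
      (Nat.card {γ // expSum hn hF k α β γ = 0} : ℤ) = 2 ^ (2 * m) - 2 ^ (2 * (m - j)) := by
  obtain ⟨i, rfl⟩ := Nat.exists_eq_add_of_le hjm
  rw [Nat.add_sub_cancel_left]
  have h := card_of_values (expSum hn hF k α β) (s := 2 ^ (j + i + j)) (by positivity)
    (expSum_cases hn hF hk hj) (a := 2 ^ i) (b := 2 ^ (2 * i))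
    (by rw [sum_expSum, hn]; ring) (by rw [sum_expSum_sq hn hF hk, hn]; ring)
  have hq : (Nat.card F : ℤ) = 2 ^ (2 * (j + i)) := by
    rw [Nat.card_eq_fintype_card, hF, hn]
    push_cast
    rfl
  rwa [hq] at h

theorem natCard_triples {A B C : Type*} [Fintype A] [Fintype B] [Fintype C]
    (Q : A → B → C → Prop) :
    Nat.card {t : A × B × C // Q t.1 t.2.1 t.2.2} =
      ∑ p : A × B, Nat.card {c // Q p.1 p.2 c} := by
  simp_rw [natCard_subtype_eq_sum, Fintype.sum_prod_type]

theorem sum_fiberwise_const {A : Type*} [Fintype A] (r : A → ℕ) (J : Finset ℕ)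
    (hJ : ∀ p, r p ∈ J) (G : ℕ → ℤ) :
    ∑ p, G (r p) = ∑ j ∈ J, Nat.card {p // r p = j} * G j := by
  rw [← Finset.sum_fiberwise_of_maps_to (fun p _ => hJ p)]
  refine Finset.sum_congr rfl fun j _ => ?_
  rw [Finset.sum_congr rfl fun p hp => by rw [(Finset.mem_filter.1 hp).2], Finset.sum_const,
    nsmul_eq_mul, Nat.card_eq_fintype_card, Fintype.card_subtype]

include hn hF in
theorem card_radical_zero (k : ℕ) : Nat.card (radical n k (0 : subfieldPow F m) (0 : F)) =
    2 ^ (2 * m) := by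
  have h1 : radical n k (0 : subfieldPow F m) (0 : F) = ⊤ := by
    rw [eq_top_iff]
    intro y _
    rw [mem_radical, polarMap_apply]
    simp
  rw [h1, AddSubgroup.card_top, Nat.card_eq_fintype_card, hF, hn]

variable [Fintype (subfieldPow F m)] {k : ℕ} (hk : k ≤ n) {r : subfieldPow F m × F → ℕ}
  (hr : ∀ p, Nat.card (radical n k p.1 p.2) = 2 ^ (2 * r p)) (hrm : ∀ p, r p ≤ m)

include hk hr hrm

/-- A nonzero value has absolute value 2^(m + r p), so only the pairs with r p = j contribute. -/
theorem card_triples_pos (j : ℕ) :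
    2 * (Nat.card {t : subfieldPow F m × F × F //
        expSum hn hF k t.1 t.2.1 t.2.2 = 2 ^ (m + j)} : ℤ) =
      Nat.card {p // r p = j} * (2 ^ (2 * (m - j)) + 2 ^ (m - j)) := by
  rw [natCard_triples fun α β γ => expSum hn hF k α β γ = 2 ^ (m + j), natCard_subtype_eq_sum]
  push_cast
  rw [Finset.mul_sum, Finset.sum_mul]
  refine Finset.sum_congr rfl fun p _ => ?_
  split_ifs with h
  · rw [← h, one_mul]
    exact (card_expSum_values hn hF hk (hrm p) (hr p)).1
  · have : IsEmpty {γ // expSum hn hF k p.1 p.2 γ = 2 ^ (m + j)} := ⟨fun ⟨γ, hγ⟩ => by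
      rcases expSum_cases hn hF hk (hr p) γ with h1 | h1 | h1 <;> rw [hγ] at h1
      · have := pow_right_injective₀ (a := (2 : ℤ)) (by norm_num) (by norm_num) h1
        omega
      · have h2 : (0 : ℤ) < 2 ^ (m + j) := by positivity
        have h3 : (0 : ℤ) < 2 ^ (m + r p) := by positivity
        linarith
      · exact absurd h1 (by positivity)⟩
    simp

theorem card_triples_neg (j : ℕ) :
    2 * (Nat.card {t : subfieldPow F m × F × F //
        expSum hn hF k t.1 t.2.1 t.2.2 = -2 ^ (m + j)} : ℤ) =
      Nat.card {p // r p = j} * (2 ^ (2 * (m - j)) - 2 ^ (m - j)) := by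
  rw [natCard_triples fun α β γ => expSum hn hF k α β γ = -2 ^ (m + j), natCard_subtype_eq_sum]
  push_cast
  rw [Finset.mul_sum, Finset.sum_mul]
  refine Finset.sum_congr rfl fun p _ => ?_
  split_ifs with h
  · rw [← h, one_mul]
    exact (card_expSum_values hn hF hk (hrm p) (hr p)).2.1
  · have : IsEmpty {γ // expSum hn hF k p.1 p.2 γ = -2 ^ (m + j)} := ⟨fun ⟨γ, hγ⟩ => by
      have h2 : (0 : ℤ) < 2 ^ (m + j) := by positivity
      have h3 : (0 : ℤ) < 2 ^ (m + r p) := by positivity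
      rcases expSum_cases hn hF hk (hr p) γ with h1 | h1 | h1 <;> rw [hγ] at h1
      · linarith
      · have := pow_right_injective₀ (a := (2 : ℤ)) (by norm_num) (by norm_num) (neg_injective h1)
        omega
      · linarith⟩
    simp

theorem card_triples_zero (J : Finset ℕ) (hJ : ∀ p, r p ∈ J) :
    (Nat.card {t : subfieldPow F m × F × F // expSum hn hF k t.1 t.2.1 t.2.2 = 0} : ℤ) =
      ∑ j ∈ J, (Nat.card {p // r p = j} : ℤ) * (2 ^ (2 * m) - 2 ^ (2 * (m - j))) := by
  rw [natCard_triples fun α β γ => expSum hn hF k α β γ = 0, ← sum_fiberwise_const r J hJ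
    fun j => 2 ^ (2 * m) - 2 ^ (2 * (m - j))]
  push_cast
  exact Finset.sum_congr rfl fun p _ => (card_expSum_values hn hF hk (hrm p) (hr p)).2.2

omit hrm

omit hk hr in
include hn hF in
theorem sum_card_classes (r : subfieldPow F m × F → ℕ) (J : Finset ℕ) (hJ : ∀ p, r p ∈ J) :
    ∑ j ∈ J, (Nat.card {p // r p = j} : ℤ) = 2 ^ (3 * m) := by
  have h := sum_fiberwise_const r J hJ fun _ => 1
  simp only [mul_one] at h
  rw [← h, Finset.sum_const, Finset.card_univ, Fintype.card_prod, hF, ← Nat.card_eq_fintype_card,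
    card_subfieldPow_half hn hF, hn]
  push_cast
  ring

include hn hF in
theorem sum_card_classes_mul (J : Finset ℕ) (hJ : ∀ p, r p ∈ J) :
    ∑ j ∈ J, (Nat.card {p // r p = j} : ℤ) * 2 ^ (2 * j) =
      2 ^ (3 * m) + (2 ^ (2 * m) - 1) * 2 ^ (m + m.gcd k) := by
  rw [← sum_fiberwise_const r J hJ fun j => 2 ^ (2 * j)]
  have h := congrArg (Nat.cast (R := ℤ)) (sum_card_radical hn hF (m := m) hk)
  have h1 : 1 ≤ 2 ^ n := Nat.one_le_two_pow
  push_cast [Nat.cast_sub h1] at h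
  rw [← hn, ← h]
  exact Finset.sum_congr rfl fun p _ => by rw [hr p]; push_cast; rfl

include hn hF in
-- Only the zero pair has radical F, because |K|² < |F|.
theorem card_class_top (hlt : Nat.card (subfieldPow F (m + k)) ^ 2 < Nat.card F) :
    Nat.card {p // r p = m} = 1 := by
  have h : ∀ p, r p = m ↔ p = 0 := by
    intro p
    constructor
    · intro hp
      by_contra h0
      have h1 := card_radical_le hn hF hk (α := p.1) (β := p.2) h0
      rw [hr p, hp, ← hn, ← hF, ← Nat.card_eq_fintype_card] at h1
      omega
    · rintro rfl
      have h2 := hr 0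
      rw [Prod.fst_zero, Prod.snd_zero, card_radical_zero hn hF] at h2
      have := Nat.pow_right_injective le_rfl h2
      omega
  rw [Nat.card_congr (Equiv.subtypeEquivRight h)]
  exact Nat.card_unique

end Counting

/-! ### Weights from values. -/

section Distribution

variable {F : Type*} [Field F] [Fintype F] [Algebra (ZMod 2) F] {n m : ℕ}
  (hn : n = 2 * m) (hF : Fintype.card F = 2 ^ n)

/-- The weight (2^n − S)/2 is an injective function of S, so the statements on weights follow from
those on values through the bijection with the code. -/
theorem isDistribution_of_values {k : ℕ} {π : F} (hπ : IsPrimitiveRoot π (2 ^ n - 1))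
    (hn0 : 0 < n)
    (hinj : Function.Injective fun p : subfieldPow F m × F × F =>
      word hn hF k π p.1 p.2.1 p.2.2)
    (hrange : Set.range (fun p : subfieldPow F m × F × F => word hn hF k π p.1 p.2.1 p.2.2) =
      (codeC2 n m k π : Set (Fin (2 ^ n - 1) → ZMod 2)))
    {t : List Row} (hweight : ∀ r ∈ t, r.weight = (2 ^ n - r.value) / 2)
    (hvalue : ∀ (α : subfieldPow F m) (β γ : F), ∃ r ∈ t,
      (expSum hn hF k α β γ : ℚ) = r.value)
    (hmult : ∀ r ∈ t, (Nat.card {p : subfieldPow F m × F × F //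
      (expSum hn hF k p.1 p.2.1 p.2.2 : ℚ) = r.value} : ℚ) = r.mult) :
    IsDistribution hn hF k π t := by
  have hw : ∀ (α : subfieldPow F m) (β γ : F), (expSum hn hF k α β γ : ℚ) =
      2 ^ n - 2 * hammingNorm (word hn hF k π α β γ) := fun α β γ => by
    rw [expSum_eq_sub_hammingNorm hn hF hπ hn0]
    push_cast
    rfl
  have hiff : ∀ r ∈ t, ∀ (α : subfieldPow F m) (β γ : F),
      (expSum hn hF k α β γ : ℚ) = r.value ↔
        (hammingNorm (word hn hF k π α β γ) : ℚ) = r.weight := fun r hr α β γ => by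
    rw [hweight r hr, hw]
    constructor <;> intro h <;> linarith
  have hsurj : ∀ c ∈ codeC2 n m k π, ∃ p : subfieldPow F m × F × F,
      word hn hF k π p.1 p.2.1 p.2.2 = c := fun c hc => by
    have : c ∈ (codeC2 n m k π : Set (Fin (2 ^ n - 1) → ZMod 2)) := hc
    rwa [← hrange] at this
  have hmem : ∀ p : subfieldPow F m × F × F, word hn hF k π p.1 p.2.1 p.2.2 ∈ codeC2 n m k π :=
    fun p => by
      have : word hn hF k π p.1 p.2.1 p.2.2 ∈
          (codeC2 n m k π : Set (Fin (2 ^ n - 1) → ZMod 2)) := by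
        rw [← hrange]
        exact ⟨p, rfl⟩
      exact this
  refine ⟨?_, hmult, ?_, ?_⟩
  · intro α β γ
    obtain ⟨r, hr, h⟩ := hvalue α β γ
    exact ⟨r, hr, h, (hiff r hr α β γ).1 h⟩
  · intro c hc
    obtain ⟨p, rfl⟩ := hsurj c hc
    obtain ⟨r, hr, h⟩ := hvalue p.1 p.2.1 p.2.2
    exact ⟨r, hr, (hiff r hr _ _ _).1 h⟩
  · intro r hr
    rw [← hmult r hr]
    congr 1
    symm
    refine Nat.card_congr (Equiv.ofBijective (fun p => ⟨⟨_, hmem p.1⟩,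
      (hiff r hr _ _ _).1 p.2⟩) ⟨?_, ?_⟩)
    · intro p p' h
      exact Subtype.ext (hinj (congrArg (fun c => (c.1 : Fin (2 ^ n - 1) → ZMod 2)) h))
    · rintro ⟨⟨c, hc⟩, hcw⟩
      obtain ⟨p, rfl⟩ := hsurj c hc
      exact ⟨⟨p, (hiff r hr _ _ _).2 hcw⟩, rfl⟩

theorem natCard_congr_value {k : ℕ} {q : ℚ} {v : ℤ} (h : (v : ℚ) = q) :
    Nat.card {p : subfieldPow F m × F × F // (expSum hn hF k p.1 p.2.1 p.2.2 : ℚ) = q} =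
      Nat.card {p : subfieldPow F m × F × F // expSum hn hF k p.1 p.2.1 p.2.2 = v} := by
  refine Nat.card_congr (Equiv.subtypeEquivRight fun p => ?_)
  rw [← h]
  exact Int.cast_inj

end Distribution

/-! ### The table entries as rational functions of 2^m and 2^d. -/

section Tables

theorem two_zpow_mul (c : ℕ) (e : ℕ) : (2 : ℚ) ^ ((c : ℤ) * (e : ℤ)) = (2 ^ e) ^ c := by
  rw [mul_comm, zpow_mul, zpow_natCast, zpow_natCast]

theorem two_zpow_two_mul (e : ℕ) : (2 : ℚ) ^ (2 * (e : ℤ)) = (2 ^ e) ^ 2 := two_zpow_mul 2 e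

theorem two_zpow_three_mul (e : ℕ) : (2 : ℚ) ^ (3 * (e : ℤ)) = (2 ^ e) ^ 3 := two_zpow_mul 3 e

theorem two_zpow_four_mul (e : ℕ) : (2 : ℚ) ^ (4 * (e : ℤ)) = (2 ^ e) ^ 4 := two_zpow_mul 4 e

theorem two_zpow_five_mul (e : ℕ) : (2 : ℚ) ^ (5 * (e : ℤ)) = (2 ^ e) ^ 5 := two_zpow_mul 5 e

theorem two_zpow_add (a b : ℤ) : (2 : ℚ) ^ (a + b) = 2 ^ a * 2 ^ b := zpow_add₀ two_ne_zero a b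

theorem two_zpow_sub (a b : ℤ) : (2 : ℚ) ^ (a - b) = 2 ^ a / 2 ^ b := zpow_sub₀ two_ne_zero a b

theorem two_pow_sub {a b : ℕ} (h : b ≤ a) : (2 : ℚ) ^ (a - b) = 2 ^ a / 2 ^ b := by
  rw [eq_div_iff (by positivity), ← pow_add, Nat.sub_add_cancel h]

theorem tableOne_weight (m d : ℕ) :
    ∀ r ∈ tableOne (2 * m : ℤ) m d, r.weight = (2 ^ (2 * m) - r.value) / 2 := by
  intro r hr
  simp only [tableOne, List.mem_cons, List.not_mem_nil, or_false] at hr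
  rcases hr with rfl | rfl | rfl | rfl | rfl | rfl <;>
  · simp only [two_zpow_add, two_zpow_sub, two_zpow_two_mul, zpow_natCast, zpow_one]
    ring

theorem tableTwo_weight (m d : ℕ) :
    ∀ r ∈ tableTwo (2 * m : ℤ) m d, r.weight = (2 ^ (2 * m) - r.value) / 2 := by
  intro r hr
  simp only [tableTwo, List.mem_cons, List.not_mem_nil, or_false] at hr
  rcases hr with rfl | rfl | rfl | rfl | rfl | rfl | rfl | rfl <;>
  · simp only [two_zpow_add, two_zpow_sub, two_zpow_two_mul, zpow_natCast, zpow_one]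
    ring

end Tables

/-! ### The case d' = d. -/

section Cases

theorem not_of_two_mul_card_eq_zero {X : Type*} [Finite X] {p : X → Prop}
    (h : 2 * (Nat.card {x // p x} : ℚ) = 1 - 1) (x : X) : ¬ p x := by
  rw [sub_self, mul_eq_zero, or_iff_right two_ne_zero, Nat.cast_eq_zero, Finite.card_eq_zero_iff,
    isEmpty_subtype] at h
  exact h x

variable {F : Type*} [Field F] [Fintype F] [Algebra (ZMod 2) F] {n m : ℕ}
  (hn : n = 2 * m) (hF : Fintype.card F = 2 ^ n)

include hn hF

/-- A nonzero pair has a radical of size `|K| ^ e` with `e ≤ 2`, `K` the fixed field of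
`x ↦ x ^ (2 ^ (m + k))`. -/
theorem exists_card_radical_eq {k d' : ℕ} (hk : k ≤ n) (hd' : n.gcd (m + k) = d') (hd'0 : 0 < d')
    {α : subfieldPow F m} {β : F} (h : (α, β) ≠ (0, 0)) :
    ∃ e ≤ 2, Nat.card (radical n k α β) = 2 ^ (d' * e) := by
  obtain ⟨e, he⟩ := card_radical_eq_pow hn hF hk α β
  have hle := card_radical_le hn hF hk h
  have h1 : 1 < 2 ^ d' := Nat.one_lt_two_pow (by omega)
  rw [card_subfieldPow hF, hd'] at he hle
  rw [he, Nat.pow_le_pow_iff_right h1] at hle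
  exact ⟨e, hle, by rw [he, pow_mul]⟩

theorem exists_rank_one {k d a : ℕ} (hk : k ≤ n) (hd : 0 < d) (hm : m = d * a)
    (hd' : n.gcd (m + k) = d) (p : subfieldPow F m × F) :
    ∃ j, Nat.card (radical n k p.1 p.2) = 2 ^ (2 * j) ∧ (j = 0 ∨ j = d ∨ j = m) := by
  by_cases h0 : p = 0
  · exact ⟨m, by rw [h0]; exact card_radical_zero hn hF k, Or.inr (Or.inr rfl)⟩
  obtain ⟨e, he, hc⟩ := exists_card_radical_eq hn hF hk hd' hd (α := p.1) (β := p.2) h0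
  -- Here K has order 2^d with d dividing m, so the parity lemma applies and excludes e = 1.
  have hKm : ∀ c ∈ subfieldPow F (m + k), c ∈ subfieldPow F m := fun c hcK => by
    have h1 : c ∈ subfieldPow F n := pow_two_pow_card hF c
    have h2 := mem_subfieldPow_gcd h1 hcK
    rw [hd'] at h2
    exact subfieldPow_mono (hm ▸ Dvd.intro a rfl) h2
  obtain ⟨s, hs⟩ := card_mul_card_radical hn hF hk hKm p.1 p.2
  rw [hc, card_subfieldPow hF, hd', Nat.card_eq_fintype_card, hF, hn, hm, ← pow_add, ← pow_mul,
    ← pow_mul] at hs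
  have hs := Nat.pow_right_injective le_rfl hs
  have hs : d * (2 * a + e) = d * (s * 2) := by linarith
  have hs := Nat.eq_of_mul_eq_mul_left hd hs
  have he2 : e = 0 ∨ e = 2 := by omega
  rcases he2 with rfl | rfl
  · exact ⟨0, by simpa using hc, Or.inl rfl⟩
  · exact ⟨d, by rw [hc, mul_comm], Or.inr (Or.inl rfl)⟩

/-- Since |K| = 2^(2d) is a square, every dimension e ≤ 2 gives a size of the form 2^(2j), and e = 1
is retained. -/
theorem exists_rank_two {k d : ℕ} (hk : k ≤ n) (hd : 0 < d)
    (hd' : n.gcd (m + k) = 2 * d) (p : subfieldPow F m × F) :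
    ∃ j, Nat.card (radical n k p.1 p.2) = 2 ^ (2 * j) ∧ (j = 0 ∨ j = d ∨ j = 2 * d ∨ j = m) := by
  by_cases h0 : p = 0
  · exact ⟨m, by rw [h0]; exact card_radical_zero hn hF k, Or.inr (Or.inr (Or.inr rfl))⟩
  obtain ⟨e, he, hc⟩ := exists_card_radical_eq hn hF hk hd' (by omega) (α := p.1) (β := p.2) h0
  refine ⟨d * e, by rw [hc, mul_assoc], ?_⟩
  interval_cases e
  · exact Or.inl (mul_zero d)
  · exact Or.inr (Or.inl (mul_one d))
  · exact Or.inr (Or.inr (Or.inl (mul_comm d 2)))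

theorem isDistribution_tableOne {k d a : ℕ} (hk : k ≤ n) (hd : 0 < d) (hm : m = d * a)
    (ha : 2 ≤ a) (hd' : n.gcd (m + k) = d) (hgcd : m.gcd k = d) {π : F}
    (hπ : IsPrimitiveRoot π (2 ^ n - 1))
    (hlt : Nat.card (subfieldPow F (m + k)) ^ 2 < Nat.card F) :
    IsDistribution hn hF k π (tableOne n m d) := by
  have := Fintype.ofFinite (subfieldPow F m)
  choose r hr hr3 using exists_rank_one hn hF hk hd hm hd'
  have hdm : d < m := by
    rw [hm]
    exact lt_mul_of_one_lt_right hd (by omega)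
  have hrm : ∀ p, r p ≤ m := fun p => by
    have := hr3 p
    omega
  have hJ : ∀ p, r p ∈ ({0, d, m} : Finset ℕ) := fun p => by
    have := hr3 p
    simp only [Finset.mem_insert, Finset.mem_singleton]
    omega
  have hsum : ∀ f : ℕ → ℤ, ∑ j ∈ ({0, d, m} : Finset ℕ), f j = f 0 + (f d + f m) := fun f => by
    rw [Finset.sum_insert (by simp; omega), Finset.sum_insert (by simp; omega),
      Finset.sum_singleton]
  have htop := card_class_top hn hF hk hr hlt
  have hnz : (n : ℤ) = 2 * (m : ℤ) := by exact_mod_cast hn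
  have hy : (2 : ℚ) ^ (m - d) = 2 ^ m / 2 ^ d := two_pow_sub hdm.le
  have e1 := congrArg (Int.cast (R := ℚ)) (sum_card_classes hn hF r _ hJ)
  have e2 := congrArg (Int.cast (R := ℚ)) (sum_card_classes_mul hn hF hk hr _ hJ)
  have pos := fun j => congrArg (Int.cast (R := ℚ)) (card_triples_pos hn hF hk hr hrm j)
  have neg := fun j => congrArg (Int.cast (R := ℚ)) (card_triples_neg hn hF hk hr hrm j)
  have zer := congrArg (Int.cast (R := ℚ)) (card_triples_zero hn hF hk hr hrm _ hJ)
  rw [hsum] at e1 e2 zer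
  rw [hgcd] at e2
  rw [htop] at e1 e2 zer
  push_cast at e1 e2 zer pos neg
  have p0 := pos 0
  have n0 := neg 0
  have p1 := pos d
  have n1 := neg d
  have p2 := pos m
  have n2 := neg m
  rw [htop] at p2 n2
  simp only [Nat.sub_zero, Nat.sub_self, Nat.cast_one, mul_zero, pow_zero, mul_one, one_mul]
    at e1 e2 p0 n0 p1 n1 p2 n2 zer
  have hD : (2 : ℚ) ≤ 2 ^ d := by
    calc (2 : ℚ) = 2 ^ 1 := (pow_one 2).symm
      _ ≤ 2 ^ d := pow_le_pow_right₀ (by norm_num) hd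
  have hD0 : (2 : ℚ) ^ d ≠ 0 := by positivity
  have hD1 : ((2 : ℚ) ^ d) ^ 2 - 1 ≠ 0 := by nlinarith
  have hx0 : (2 : ℚ) ^ m ≠ 0 := by positivity
  simp only [pow_mul', pow_add, hy] at e1 e2 p0 n0 p1 n1 p2 n2 zer
  -- The total count and the weighted count are subtracted to eliminate the class j = 0; the class j
  -- = m has one element.
  have hN1 : (Nat.card {p // r p = d} : ℚ) =
      ((2 ^ m) ^ 2 - 1) * (2 ^ m * 2 ^ d - 1) / ((2 ^ d) ^ 2 - 1) := by
    rw [eq_div_iff hD1]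
    linear_combination e2 - e1
  have hN0 : (Nat.card {p // r p = 0} : ℚ) = (2 ^ m) ^ 3 - 1 -
      ((2 ^ m) ^ 2 - 1) * (2 ^ m * 2 ^ d - 1) / ((2 ^ d) ^ 2 - 1) := by
    rw [← hN1]
    linear_combination e1
  rw [hN0] at p0 n0 zer
  rw [hN1] at p1 n1 zer
  refine isDistribution_of_values hn hF hπ (by omega) (word_injective hn hF hk (by omega) hlt hπ)
    (range_word hn hF hk (by omega) hlt hπ) ?_ ?_ ?_
  · rw [hnz, hn]
    exact tableOne_weight m d
  · intro α β γ
    -- For j = m the count of the negative value is (1 − 1)/2 = 0, so −2^n has no row.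
    have hneg : expSum hn hF k α β γ ≠ -(2 ^ m * 2 ^ m) := fun h =>
      not_of_two_mul_card_eq_zero n2 (α, β, γ) h
    rw [hnz]
    simp only [tableOne, List.exists_mem_cons_iff, List.not_mem_nil, false_and, exists_false,
      or_false, two_zpow_add, two_zpow_two_mul, zpow_natCast]
    have hv := expSum_cases hn hF hk (hr (α, β)) γ
    rw [pow_add] at hv
    rcases hr3 (α, β) with h | h | h <;> rw [h] at hv <;> rcases hv with hv | hv | hv <;>
      first
        | exact absurd hv hneg
        | (rw [hv]; push_cast; simp [sq])
  · rw [hnz]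
    intro row hrow
    simp only [tableOne, List.mem_cons, List.not_mem_nil, or_false] at hrow
    rcases hrow with rfl | rfl | rfl | rfl | rfl | rfl <;>
    simp only [two_zpow_add, two_zpow_sub, two_zpow_two_mul, two_zpow_three_mul, zpow_natCast,
      zpow_one]
    · rw [natCard_congr_value hn hF (v := 2 ^ m * 2 ^ 0) (by push_cast; ring)]
      refine mul_left_cancel₀ two_ne_zero (p0.trans ?_)
      generalize (2 : ℚ) ^ m = x at *
      generalize (2 : ℚ) ^ d = D at *
      field_simp
      ring
    · rw [natCard_congr_value hn hF (v := -(2 ^ m * 2 ^ 0)) (by push_cast; ring)]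
      refine mul_left_cancel₀ two_ne_zero (n0.trans ?_)
      generalize (2 : ℚ) ^ m = x at *
      generalize (2 : ℚ) ^ d = D at *
      field_simp
      ring
    · rw [natCard_congr_value hn hF (v := 2 ^ m * 2 ^ d) (by push_cast; ring)]
      refine mul_left_cancel₀ two_ne_zero (p1.trans ?_)
      generalize (2 : ℚ) ^ m = x at *
      generalize (2 : ℚ) ^ d = D at *
      field_simp
    · rw [natCard_congr_value hn hF (v := -(2 ^ m * 2 ^ d)) (by push_cast; ring)]
      refine mul_left_cancel₀ two_ne_zero (n1.trans ?_)
      generalize (2 : ℚ) ^ m = x at *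
      generalize (2 : ℚ) ^ d = D at *
      field_simp
    · rw [natCard_congr_value hn hF (v := 0) (by push_cast; ring), zer]
      generalize (2 : ℚ) ^ m = x at *
      generalize (2 : ℚ) ^ d = D at *
      field_simp
      ring
    · rw [natCard_congr_value hn hF (v := 2 ^ m * 2 ^ m) (by push_cast; ring)]
      linarith

end Cases

/-- Since 2^d ≡ −1, the residue of 2^(dt) is (−1)^t. A wrong sign or a zero would make 2^d + 1 ≥ 3
divide 2 or 1. -/
theorem eq_neg_one_pow_mul_of_dvd {d t : ℕ} (hd : 0 < d) {S : ℤ}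
    (hS : S = 2 ^ (d * t) ∨ S = -2 ^ (d * t) ∨ S = 0)
    (hdvd : ((2 ^ d + 1 : ℕ) : ℤ) ∣ S - 1) : S = (-1) ^ t * 2 ^ (d * t) := by
  have h3 : (2 : ℤ) ^ 1 ≤ 2 ^ d := pow_le_pow_right₀ (by norm_num) hd
  have hM : (3 : ℤ) ≤ ((2 ^ d + 1 : ℕ) : ℤ) := by
    push_cast
    linarith
  have h1 : ((2 ^ d + 1 : ℕ) : ℤ) ∣ 2 ^ (d * t) - (-1) ^ t := by
    have := sub_dvd_pow_sub_pow ((2 : ℤ) ^ d) (-1) t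
    rw [sub_neg_eq_add, ← pow_mul] at this
    exact_mod_cast this
  have small : ∀ c : ℤ, ((2 ^ d + 1 : ℕ) : ℤ) ∣ c → c ≠ 0 → 3 ≤ |c| := fun c hc h0 =>
    hM.trans (Int.le_of_dvd (abs_pos.2 h0) ((dvd_abs _ _).2 hc))
  rcases neg_one_pow_eq_or ℤ t with ht | ht <;> rw [ht] at h1 ⊢ <;> rcases hS with hS | hS | hS
  · rw [hS, one_mul]
  · have h2 := small _ (dvd_add hdvd h1) (by rw [hS]; omega)
    rw [hS, show -2 ^ (d * t) - 1 + (2 ^ (d * t) - 1) = (-2 : ℤ) by ring] at h2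
    norm_num at h2
  · have h2 := small _ hdvd (by rw [hS]; norm_num)
    rw [hS] at h2
    norm_num at h2
  · have h2 := small _ (dvd_sub hdvd h1) (by rw [hS]; omega)
    rw [hS, show (2 : ℤ) ^ (d * t) - 1 - (2 ^ (d * t) - -1) = (-2 : ℤ) by ring] at h2
    norm_num at h2
  · rw [hS, neg_one_mul]
  · have h2 := small _ hdvd (by rw [hS]; norm_num)
    rw [hS] at h2
    norm_num at h2

/-! ### The case d' = 2d. -/

section Cases

variable {F : Type*} [Field F] [Fintype F] [Algebra (ZMod 2) F] {n m : ℕ}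
  (hn : n = 2 * m) (hF : Fintype.card F = 2 ^ n)

include hn hF

theorem isDistribution_tableTwo {k d a b : ℕ} (hk : k ≤ n) (hd : 0 < d) (hm : m = d * a)
    (hkb : k = d * b) (ha : Odd a) (hb : Odd b)
    (ha3 : 3 ≤ a) (hd' : n.gcd (m + k) = 2 * d) (hgcd : m.gcd k = d) {π : F}
    (hπ : IsPrimitiveRoot π (2 ^ n - 1))
    (hlt : Nat.card (subfieldPow F (m + k)) ^ 2 < Nat.card F) :
    IsDistribution hn hF k π (tableTwo n m d) := by
  have := Fintype.ofFinite (subfieldPow F m)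
  choose r hr hr3 using exists_rank_two hn hF hk hd hd'
  have hdm : 2 * d < m := by
    rw [hm, mul_comm]
    exact Nat.mul_lt_mul_of_pos_left (by omega) hd
  have hrm : ∀ p, r p ≤ m := fun p => by
    have := hr3 p
    omega
  have hJ : ∀ p, r p ∈ ({0, d, 2 * d, m} : Finset ℕ) := fun p => by
    have := hr3 p
    simp only [Finset.mem_insert, Finset.mem_singleton]
    omega
  have hsum : ∀ f : ℕ → ℤ, ∑ j ∈ ({0, d, 2 * d, m} : Finset ℕ), f j =
      f 0 + (f d + (f (2 * d) + f m)) := fun f => by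
    rw [Finset.sum_insert (by simp only [Finset.mem_insert, Finset.mem_singleton]; omega),
      Finset.sum_insert (by simp only [Finset.mem_insert, Finset.mem_singleton]; omega),
      Finset.sum_insert (by simp only [Finset.mem_singleton]; omega), Finset.sum_singleton]
  have hsign : ∀ p : subfieldPow F m × F, ∀ t, r p = d * t →
      expSum hn hF k p.1 p.2 0 = (-1) ^ (a + t) * 2 ^ (m + r p) := fun p t ht => by
    have h1 := expSum_cases hn hF hk (hr p) 0
    have h2 := expSum_zero_modEq hn hF hπ (by omega) hm hkb ha hb p.1 p.2
    have h3 : m + r p = d * (a + t) := by rw [hm, ht, mul_add]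
    rw [h3] at h1 ⊢
    exact eq_neg_one_pow_mul_of_dvd hd h1 h2
  -- The sign is (−1)^(a + t) with r = d t and a odd. It is negative for t = 0, 2 and positive for t
  -- = 1 and t = a, the last being r = m.
  set G : ℕ → ℤ := fun j => (if j = d ∨ j = m then 1 else -1) * 2 ^ (m + j) with hG
  have hSG : ∀ p, expSum hn hF k p.1 p.2 0 = G (r p) := fun p => by
    rcases hr3 p with h | h | h | h
    · rw [hsign p 0 (by simpa using h), add_zero, ha.neg_one_pow, hG]
      simp only
      rw [if_neg (by omega)]
    · rw [hsign p 1 (by simpa using h), ha.add_one.neg_one_pow, hG]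
      simp only
      rw [if_pos (by omega)]
    · rw [hsign p 2 (by rw [h, mul_comm]), (ha.add_even even_two).neg_one_pow, hG]
      simp only
      rw [if_neg (by omega)]
    · rw [hsign p a (by rw [h, hm]), (ha.add_odd ha).neg_one_pow, hG]
      simp only
      rw [if_pos (by omega)]
  have e3 := sum_expSum_zero hn hF k
  rw [Finset.sum_congr rfl fun p _ => hSG p, sum_fiberwise_const r _ hJ G, hsum] at e3
  have hG0 : G 0 = -2 ^ m := by
    simp only [hG]
    rw [if_neg (by omega), neg_one_mul, add_zero]
  have hG1 : G d = 2 ^ (m + d) := by simp [hG]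
  have hG2 : G (2 * d) = -2 ^ (m + 2 * d) := by
    simp only [hG]
    rw [if_neg (by omega), neg_one_mul]
  have hG3 : G m = 2 ^ (m + m) := by simp [hG]
  rw [hG0, hG1, hG2, hG3] at e3
  have htop := card_class_top hn hF hk hr hlt
  have hnz : (n : ℤ) = 2 * (m : ℤ) := by exact_mod_cast hn
  have hy : (2 : ℚ) ^ (m - d) = 2 ^ m / 2 ^ d := two_pow_sub (by omega)
  have hy2 : (2 : ℚ) ^ (m - 2 * d) = 2 ^ m / (2 ^ d) ^ 2 := by
    rw [two_pow_sub hdm.le, pow_mul']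
  have e1 := congrArg (Int.cast (R := ℚ)) (sum_card_classes hn hF r _ hJ)
  have e2 := congrArg (Int.cast (R := ℚ)) (sum_card_classes_mul hn hF hk hr _ hJ)
  have e3 := congrArg (Int.cast (R := ℚ)) e3
  have pos := fun j => congrArg (Int.cast (R := ℚ)) (card_triples_pos hn hF hk hr hrm j)
  have neg := fun j => congrArg (Int.cast (R := ℚ)) (card_triples_neg hn hF hk hr hrm j)
  have zer := congrArg (Int.cast (R := ℚ)) (card_triples_zero hn hF hk hr hrm _ hJ)
  rw [hsum] at e1 e2 zer
  rw [hgcd] at e2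
  rw [htop] at e1 e2 e3 zer
  push_cast at e1 e2 e3 zer pos neg
  have p0 := pos 0
  have n0 := neg 0
  have p1 := pos d
  have n1 := neg d
  have p2 := pos (2 * d)
  have n2 := neg (2 * d)
  have p3 := pos m
  have n3 := neg m
  rw [htop] at p3 n3
  simp only [Nat.sub_zero, Nat.sub_self, Nat.cast_one, mul_zero, pow_zero, mul_one, one_mul]
    at e1 e2 e3 p0 n0 p1 n1 p2 n2 p3 n3 zer
  have hD : (2 : ℚ) ≤ 2 ^ d := by
    calc (2 : ℚ) = 2 ^ 1 := (pow_one 2).symm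
      _ ≤ 2 ^ d := pow_le_pow_right₀ (by norm_num) hd
  have hD0 : (2 : ℚ) ^ d ≠ 0 := by positivity
  have hD1 : ((2 : ℚ) ^ d) ^ 2 - 1 ≠ 0 := by nlinarith
  have hD2 : (2 : ℚ) ^ d + 1 ≠ 0 := by positivity
  have hx0 : (2 : ℚ) ^ m ≠ 0 := by positivity
  simp only [pow_mul' (2 : ℚ), pow_add (2 : ℚ), hy, hy2]
    at e1 e2 e3 p0 n0 p1 n1 p2 n2 p3 n3 zer
  have e4 : -(Nat.card {p // r p = 0} : ℚ) + 2 ^ d * Nat.card {p // r p = d} -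
      (2 ^ d) ^ 2 * Nat.card {p // r p = 2 * d} + 2 ^ m = (2 ^ m) ^ 2 := by
    refine mul_left_cancel₀ hx0 ?_
    linear_combination e3
  have hN2 : (Nat.card {p // r p = 2 * d} : ℚ) = (2 ^ m / 2 ^ d - 1) * ((2 ^ m) ^ 2 - 1) /
      ((2 ^ d + 1) * ((2 ^ d) ^ 2 - 1)) := by
    -- With D = 2^d, eliminating the classes 0 and d leaves the coefficient D(D + 1)(D² − 1), hence
    -- the extra factor D introduced next.
    rw [eq_div_iff (mul_ne_zero hD2 hD1)]
    refine mul_left_cancel₀ hD0 ?_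
    rw [← mul_assoc, ← mul_assoc (2 ^ d), mul_sub (2 ^ d), mul_div_cancel₀ _ hD0]
    linear_combination (e2 - e1) - (2 ^ d - 1) * (e1 + e4)
  have hN1 : (Nat.card {p // r p = d} : ℚ) = 2 ^ d * ((2 ^ m) ^ 2 - 1) *
      (2 ^ m + 2 ^ m / 2 ^ d + 2 ^ m / (2 ^ d) ^ 2 + 1) / (2 ^ d + 1) ^ 2 := by
    have h1 : (2 ^ d + 1) * (Nat.card {p // r p = d} : ℚ) =
        (2 ^ m + 1) * ((2 ^ m) ^ 2 - 1) +
          ((2 ^ d) ^ 2 - 1) * Nat.card {p // r p = 2 * d} := by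
      linear_combination e1 + e4
    rw [hN2] at h1
    refine mul_left_cancel₀ hD2 (h1.trans ?_)
    generalize (2 : ℚ) ^ m = x at *
    generalize (2 : ℚ) ^ d = D at *
    field_simp
    ring
  have hN0 : (Nat.card {p // r p = 0} : ℚ) = (2 ^ m) ^ 3 - 1 - Nat.card {p // r p = d} -
      Nat.card {p // r p = 2 * d} := by
    linear_combination e1
  rw [hN0, hN1, hN2] at p0 n0 zer
  rw [hN1] at p1 n1
  rw [hN2] at p2 n2
  refine isDistribution_of_values hn hF hπ (by omega) (word_injective hn hF hk (by omega) hlt hπ)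
    (range_word hn hF hk (by omega) hlt hπ) ?_ ?_ ?_
  · rw [hnz, hn]
    exact tableTwo_weight m d
  · intro α β γ
    have hneg : expSum hn hF k α β γ ≠ -2 ^ (m + m) := fun h =>
      not_of_two_mul_card_eq_zero n3 (α, β, γ) h
    rw [hnz]
    simp only [tableTwo, List.exists_mem_cons_iff, List.not_mem_nil, false_and, exists_false,
      or_false, two_zpow_add, two_zpow_two_mul, zpow_natCast]
    have hv := expSum_cases hn hF hk (hr (α, β)) γ
    rcases hr3 (α, β) with h | h | h | h <;> rw [h] at hv <;> rcases hv with hv | hv | hv <;>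
      first
        | exact absurd hv hneg
        | (rw [hv]; push_cast; simp [sq, two_mul, pow_add])
  · rw [hnz]
    intro row hrow
    simp only [tableTwo, List.mem_cons, List.not_mem_nil, or_false] at hrow
    rcases hrow with rfl | rfl | rfl | rfl | rfl | rfl | rfl | rfl <;>
    simp only [two_zpow_add, two_zpow_sub, two_zpow_two_mul, two_zpow_three_mul,
      two_zpow_four_mul, two_zpow_five_mul, zpow_natCast, zpow_one]
    · rw [natCard_congr_value hn hF (v := 2 ^ (m + 0)) (by push_cast; ring)]
      refine mul_left_cancel₀ two_ne_zero (p0.trans ?_)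
      generalize (2 : ℚ) ^ m = x at *
      generalize (2 : ℚ) ^ d = D at *
      field_simp
      ring
    · rw [natCard_congr_value hn hF (v := -2 ^ (m + 0)) (by push_cast; ring)]
      refine mul_left_cancel₀ two_ne_zero (n0.trans ?_)
      generalize (2 : ℚ) ^ m = x at *
      generalize (2 : ℚ) ^ d = D at *
      field_simp
      ring
    · rw [natCard_congr_value hn hF (v := 2 ^ (m + d)) (by push_cast; ring)]
      refine mul_left_cancel₀ two_ne_zero (p1.trans ?_)
      generalize (2 : ℚ) ^ m = x at *
      generalize (2 : ℚ) ^ d = D at *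
      field_simp
    · rw [natCard_congr_value hn hF (v := -2 ^ (m + d)) (by push_cast; ring)]
      refine mul_left_cancel₀ two_ne_zero (n1.trans ?_)
      generalize (2 : ℚ) ^ m = x at *
      generalize (2 : ℚ) ^ d = D at *
      field_simp
    · rw [natCard_congr_value hn hF (v := 2 ^ (m + 2 * d)) (by push_cast; ring)]
      refine mul_left_cancel₀ two_ne_zero (p2.trans ?_)
      generalize (2 : ℚ) ^ m = x at *
      generalize (2 : ℚ) ^ d = D at *
      field_simp
    · rw [natCard_congr_value hn hF (v := -2 ^ (m + 2 * d)) (by push_cast; ring)]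
      refine mul_left_cancel₀ two_ne_zero (n2.trans ?_)
      generalize (2 : ℚ) ^ m = x at *
      generalize (2 : ℚ) ^ d = D at *
      field_simp
    · rw [natCard_congr_value hn hF (v := 0) (by push_cast; ring), zer]
      generalize (2 : ℚ) ^ m = x at *
      generalize (2 : ℚ) ^ d = D at *
      field_simp
      ring
    · rw [natCard_congr_value hn hF (v := 2 ^ (m + m)) (by push_cast; ring)]
      linarith

end Cases
end GenKasami
end

theorem mainTheorem3 {F : Type*} [Field F] [Fintype F] [Algebra (ZMod 2) F]
    (n m k d d' : ℕ) (hn : n = 2 * m) (hF : Fintype.card F = 2 ^ n)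
    (hk1 : 1 ≤ k) (hkn : k ≤ n - 1) (hkm : k ≠ m)
    (hd : d = Nat.gcd m k) (hd' : d' = Nat.gcd (m + k) (2 * k))
    (π : F) (hπ : IsPrimitiveRoot π (2 ^ n - 1)) :
    (Function.Injective
        (fun p : GenKasami.subfieldPow F m × F × F =>
          GenKasami.word hn hF k π p.1 p.2.1 p.2.2) ∧
      Set.range
        (fun p : GenKasami.subfieldPow F m × F × F =>
          GenKasami.word hn hF k π p.1 p.2.1 p.2.2) =
        (GenKasami.codeC2 n m k π : Set (Fin (2 ^ n - 1) → ZMod 2))) ∧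
    (d' = d → GenKasami.IsDistribution hn hF k π (GenKasami.tableOne n m d)) ∧
    (d' = 2 * d → GenKasami.IsDistribution hn hF k π (GenKasami.tableTwo n m d)) := by
  obtain ⟨d₀, a, b, hd₀, hdpos, hma, hkb, ha2, hcase⟩ :=
    GenKasami.gcd_cases hk1 (m := m) (by omega) hkm
  rw [← hd] at hd₀
  subst hd₀
  have hgcd : n.gcd (m + k) = d' := by rw [hn, GenKasami.gcd_two_mul_add, hd']
  have hk : k ≤ n := by omega
  -- This gives |K|² = 2^(2d') < 2^n, on which both injectivity and the uniqueness of the pair with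
  -- radical F depend.
  have hd'm : d' < m := by
    rw [hma, hd']
    rcases hcase with h | ⟨h, -, -, h3⟩
    · rw [← hma, h, hma]
      exact lt_mul_of_one_lt_right hdpos (by omega)
    · rw [← hma, h, hma, mul_comm]
      exact Nat.mul_lt_mul_of_pos_left (by omega) hdpos
  have hlt : Nat.card (GenKasami.subfieldPow F (m + k)) ^ 2 < Nat.card F := by
    rw [GenKasami.card_subfieldPow hF, hgcd, Nat.card_eq_fintype_card, hF, ← pow_mul]
    exact Nat.pow_lt_pow_right (by norm_num) (by omega)
  refine ⟨⟨GenKasami.word_injective hn hF hk (by omega) hlt hπ,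
    GenKasami.range_word hn hF hk (by omega) hlt hπ⟩, fun h => ?_, fun h => ?_⟩
  · exact GenKasami.isDistribution_tableOne hn hF hk hdpos hma ha2 (hgcd.trans h) hd.symm hπ hlt
  · rcases hcase with h' | ⟨-, ha, hb, ha3⟩
    · omega
    · exact GenKasami.isDistribution_tableTwo hn hF hk hdpos hma hkb ha hb ha3 (hgcd.trans h)
        hd.symm hπ hlt
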